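/- Let $f$ be a transcendental entire function (an entire function $f:\mathbb{C}\to\mathbb{C}$ that is not a polynomial), let $Q_1, Q_2, R$ be rational functions of $z$ with complex coefficients such that $Q_1\not\equiv 0$ and $Q_2\not\equiv 0$, let $n\ge 3$ be an integer, and let $q\ge 0$ be an integer, with $f^{(0)}=f$. Then the meromorphic function $$Q_1 f^n + Q_2 f^{(q)} - R$$ has infinitely many zeros in $\mathbb{C}$, even if points at which $Q_1$, $Q_2$ or $R$ has a pole are not counted. Moreover, $$Q_1 f^n - Q_2 f^{(q)}$$ has infinitely many fixed points: there are infinitely many $z\in\mathbb{C}$, not poles of $Q_1$ or $Q_2$, such that $Q_1(z)f(z)^n - Q_2(z)f^{(q)}(z) = z$. -/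

import Mathlib

/-- `f` is a transcendental entire function: holomorphic on the whole plane and not a polynomial. -/
def IsTranscendentalEntire (f : ℂ → ℂ) : Prop :=
  Differentiable ℂ f ∧ ¬ ∃ p : Polynomial ℂ, ∀ z : ℂ, f z = p.eval z

/-- The value of the rational function `Q` at `z`. It is meaningful where `Q` has no pole;
at a pole it is a junk value. -/
noncomputable def ratValue (Q : RatFunc ℂ) (z : ℂ) : ℂ :=
  RatFunc.eval (RingHom.id ℂ) z Q

/-- `Q` has no pole at `z`: the denominator of `Q` in lowest terms does not vanish there. -/
def NoPoleAt (Q : RatFunc ℂ) (z : ℂ) : Prop :=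
  Q.denom.eval z ≠ 0

/-!
The proof is the Tumura–Clunie argument of Nevanlinna theory, made self-contained for entire
functions.

After clearing denominators the coefficients are polynomials `A`, `B`, `C`. Suppose that
`F = G + D`, with `G = A f ^ n` and `D = B f⁽q⁾ - C`, has only finitely many zeros. Then
`p F' = β F` with a polynomial `p ≠ 0` and an entire function `β`
(`exists_polynomial_mul_deriv_eq`). Hence `p G' - β G = β D - p D'`. The left-hand side is
`f ^ (n - 1) φ` with the entire function `φ = p (A' f + n A f') - β A f`.

* If `φ ≠ 0`, both expressions are used. Where `‖f‖ ≤ 1`, `φ / f` is a combination of polynomials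
  and logarithmic derivatives. Where `‖f‖ ≥ 1`, the right-hand side divided by `f` is bounded by
  such a combination, and `n - 1 ≥ 2`. So `φ` and `f φ` both have proximity function `S(r, f)`
  (`ProximitySmall`) by the lemma on the logarithmic derivative (`ProximitySmall.norm_logDeriv`).
  By Jensen's inequality for `φ`, so does `f` (`ProximitySmall.of_mul`). As `f` is entire, its
  proximity function is its characteristic, and with Borel's growth lemma `f` is a polynomial
  (`exists_iteratedDeriv_eq_zero_of_small`), a contradiction.
* If `φ = 0`, then `F` and `G` solve the same first order linear equation, so `F = c G`
  (`exists_eq_mul_of_deriv_eq`) and `B f⁽q⁾ - C = (c - 1) A f ^ n`. For `c = 1`, `f⁽q⁾` is rational;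
  for `c ≠ 1`, `f` is again small compared with itself. Both are impossible.

The lemma on the logarithmic derivative comes from dividing out a Blaschke product: what is left
has no zeros in a disc, so Borel–Carathéodory and Cauchy's estimate apply, while the number of
zeros is bounded by the growth, and each contributes `‖z - a‖ ^ (-1/2)`, of bounded average, to the
square root. Estimates are stated for all radii `r`, gaps `δ` and bounds `exp L` for `‖f‖` on the disc
of radius `r + δ` (`DiscBound`). This makes "small" a pointwise notion and leaves exceptional
sets of radii to a single use of the growth lemma.
-/

open Metric Filter Topology Real

/-! ### Splitting off the zeros of an entire function in a disc -/

lemma exists_eq_sub_mul_of_eq_zero {g : ℂ → ℂ} (hg : Differentiable ℂ g) {a : ℂ} (ha : g a = 0) :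
    ∃ h : ℂ → ℂ, Differentiable ℂ h ∧ ∀ z, g z = (z - a) * h z := by
  refine ⟨dslope g a, ?_, fun z => ?_⟩
  · rw [← differentiableOn_univ, Complex.differentiableOn_dslope Filter.univ_mem]
    exact hg.differentiableOn
  · have := sub_smul_dslope g a z
    rw [ha, sub_zero, smul_eq_mul] at this
    exact this.symm

/-- On the circle `‖z‖ = R`, the point `a` and its mirror image with respect to that circle
give linear factors of the same modulus. -/
lemma norm_reflected_factor {R : ℝ} (hR : 0 < R) (a : ℂ) {z : ℂ} (hz : ‖z‖ = R) :
    ‖((R : ℂ) ^ 2 - starRingEnd ℂ a * z) / R‖ = ‖z - a‖ := by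
  have h1 : ((R : ℂ) ^ 2 - starRingEnd ℂ a * z) = z * starRingEnd ℂ (z - a) := by
    rw [map_sub, mul_sub, Complex.mul_conj, Complex.normSq_eq_norm_sq, hz]
    push_cast; ring
  rw [h1, norm_div, norm_mul, hz, RCLike.norm_conj, Complex.norm_real, Real.norm_eq_abs,
    abs_of_pos hR]
  field_simp

/-- The reflected factors stay away from zero well inside the disc of radius `R`. -/
lemma reflected_factor_lower_bound {R ρ r : ℝ} (hρR : ρ ≤ R) {a z : ℂ}
    (ha : ‖a‖ ≤ ρ) (hz : ‖z‖ ≤ r) :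
    R * (R - r) ≤ ‖(R : ℂ) ^ 2 - starRingEnd ℂ a * z‖ := by
  have hR : 0 ≤ R := (norm_nonneg a).trans (ha.trans hρR)
  have h1 : ‖(R : ℂ) ^ 2‖ = R ^ 2 := by
    rw [norm_pow, Complex.norm_real, Real.norm_eq_abs, abs_of_nonneg hR]
  have h2 : ‖starRingEnd ℂ a * z‖ ≤ R * r := by
    rw [norm_mul, RCLike.norm_conj]
    exact mul_le_mul (ha.trans hρR) hz (norm_nonneg _) hR
  have h3 := norm_sub_norm_le ((R : ℂ) ^ 2) (starRingEnd ℂ a * z)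
  nlinarith

/-- If `g z = ∏ (z - a i) * h z`, this is `h z * ∏ (R² - conj (a i) z) / R`: the quotient of `g` by
the Blaschke product of the disc of radius `R` with zeros `a i`. -/
noncomputable def reflectZeros (R : ℝ) (N : ℕ) (a : ℕ → ℂ) (h : ℂ → ℂ) (z : ℂ) : ℂ :=
  (∏ i ∈ Finset.range N, ((R : ℂ) ^ 2 - starRingEnd ℂ (a i) * z) / R) * h z

lemma differentiable_reflectZeros {R : ℝ} {N : ℕ} {a : ℕ → ℂ} {h : ℂ → ℂ}
    (hh : Differentiable ℂ h) : Differentiable ℂ (reflectZeros R N a h) := by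
  unfold reflectZeros
  fun_prop

lemma norm_reflectZeros_le {g h : ℂ → ℂ} {N : ℕ} {a : ℕ → ℂ} {R M : ℝ} (hR : 0 < R)
    (hh : Differentiable ℂ h) (hfac : ∀ z, g z = (∏ i ∈ Finset.range N, (z - a i)) * h z)
    (hM : ∀ z, ‖z‖ ≤ R → ‖g z‖ ≤ M) {z : ℂ} (hz : ‖z‖ ≤ R) :
    ‖reflectZeros R N a h z‖ ≤ M := by
  refine Complex.norm_le_of_forall_mem_frontier_norm_le (U := ball 0 R) isBounded_ball
    (differentiable_reflectZeros hh).diffContOnCl ?_ ?_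
  · intro w hw
    rw [frontier_ball _ hR.ne', mem_sphere_zero_iff_norm] at hw
    have : ‖reflectZeros R N a h w‖ = ‖g w‖ := by
      rw [hfac, reflectZeros, norm_mul, norm_mul, norm_prod, norm_prod]
      congr 1
      exact Finset.prod_congr rfl fun i _ => norm_reflected_factor hR _ hw
    rw [this]
    exact hM w hw.le
  · rw [closure_ball _ hR.ne']
    simpa using hz

/-- Reflecting the zeros outwards enlarges the value at the centre, exponentially in their number. -/
lemma norm_le_norm_reflectZeros_zero {g h : ℂ → ℂ} {N : ℕ} {a : ℕ → ℂ} {ρ R : ℝ} (hρ : 0 < ρ)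
    (hρR : ρ ≤ R) (hfac : ∀ z, g z = (∏ i ∈ Finset.range N, (z - a i)) * h z)
    (ha : ∀ i < N, ‖a i‖ ≤ ρ) : ‖g 0‖ * (R / ρ) ^ N ≤ ‖reflectZeros R N a h 0‖ := by
  have hR : 0 < R := hρ.trans_le hρR
  have h1 : ‖reflectZeros R N a h 0‖ = R ^ N * ‖h 0‖ := by
    rw [reflectZeros, norm_mul, norm_prod]
    congr 1
    rw [Finset.prod_congr rfl (g := fun _ => R)]
    · simp
    · intro i _
      rw [mul_zero, sub_zero, norm_div, norm_pow, Complex.norm_real, Real.norm_eq_abs,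
        abs_of_pos hR]
      field_simp
  have h2 : ‖g 0‖ ≤ ρ ^ N * ‖h 0‖ := by
    rw [hfac, norm_mul, norm_prod]
    gcongr
    calc ∏ i ∈ Finset.range N, ‖0 - a i‖ ≤ ∏ i ∈ Finset.range N, ρ := by
          refine Finset.prod_le_prod (fun _ _ => norm_nonneg _) fun i hi => ?_
          rw [zero_sub, norm_neg]
          exact ha i (Finset.mem_range.1 hi)
      _ = ρ ^ N := by simp
  rw [h1, div_pow, mul_div_assoc', div_le_iff₀ (by positivity)]
  calc ‖g 0‖ * R ^ N ≤ ρ ^ N * ‖h 0‖ * R ^ N := by gcongr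
    _ = _ := by ring

/-- A Jensen-type bound for the number `N` of zeros in the disc of radius `ρ`, by the maximum
principle on a larger disc. -/
lemma zero_count_bound {g h : ℂ → ℂ} {N : ℕ} {a : ℕ → ℂ} {ρ R M : ℝ} (hρ : 0 < ρ)
    (hρR : ρ ≤ R) (hh : Differentiable ℂ h)
    (hfac : ∀ z, g z = (∏ i ∈ Finset.range N, (z - a i)) * h z)
    (ha : ∀ i < N, ‖a i‖ ≤ ρ) (hM : ∀ z, ‖z‖ ≤ R → ‖g z‖ ≤ M) :
    ‖g 0‖ * (R / ρ) ^ N ≤ M :=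
  (norm_le_norm_reflectZeros_zero hρ hρR hfac ha).trans
    (norm_reflectZeros_le (hρ.trans_le hρR) hh hfac hM (by simpa using (hρ.trans_le hρR).le))

lemma exists_norm_le_of_continuous {g : ℂ → ℂ} (hg : Continuous g) (R : ℝ) :
    ∃ M : ℝ, ∀ z, ‖z‖ ≤ R → ‖g z‖ ≤ M := by
  obtain ⟨M, hM⟩ := (isCompact_closedBall (0 : ℂ) R).exists_bound_of_continuousOn hg.continuousOn
  exact ⟨M, fun z hz => hM z (by simpa using hz)⟩

lemma exists_factorization_closedBall_of_ne_zero {g : ℂ → ℂ} (hg : Differentiable ℂ g)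
    (hg0 : g 0 ≠ 0) {ρ : ℝ} (hρ : 0 < ρ) :
    ∃ (N : ℕ) (a : ℕ → ℂ) (h : ℂ → ℂ), Differentiable ℂ h ∧ (∀ i < N, ‖a i‖ ≤ ρ) ∧
      (∀ z, g z = (∏ i ∈ Finset.range N, (z - a i)) * h z) ∧ ∀ z, ‖z‖ ≤ ρ → h z ≠ 0 := by
  classical
  let P : ℕ → Prop := fun N => ∃ (a : ℕ → ℂ) (h : ℂ → ℂ), Differentiable ℂ h ∧
    (∀ i < N, ‖a i‖ ≤ ρ) ∧ (∀ z, g z = (∏ i ∈ Finset.range N, (z - a i)) * h z)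
  -- The number of zeros that can be split off is bounded, so a maximal splitting exists.
  obtain ⟨M, hM⟩ := exists_norm_le_of_continuous hg.continuous (2 * ρ)
  have hbdd : ∃ B : ℕ, ∀ N, P N → N ≤ B := by
    obtain ⟨B, hB⟩ := pow_unbounded_of_one_lt (M / ‖g 0‖) (one_lt_two)
    refine ⟨B, fun N ⟨a, h, hh, ha, hfac⟩ => ?_⟩
    by_contra! hlt
    have h1 := zero_count_bound hρ (by linarith : ρ ≤ 2 * ρ) hh hfac ha hM
    rw [mul_div_assoc, div_self hρ.ne', mul_one, mul_comm, ← le_div_iff₀ (norm_pos_iff.2 hg0)] at h1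
    have h2 : (2 : ℝ) ^ B ≤ 2 ^ N := pow_le_pow_right₀ one_le_two hlt.le
    linarith
  obtain ⟨B, hB⟩ := hbdd
  have hP0 : P 0 := ⟨fun _ => 0, g, hg, by simp, by simp⟩
  have hspec := Nat.findGreatest_spec (P := P) (Nat.zero_le B) hP0
  have hmax : ∀ N, P N → N ≤ Nat.findGreatest P B := fun N hN => Nat.le_findGreatest (hB N hN) hN
  set N := Nat.findGreatest P B
  obtain ⟨a, h, hh, ha, hfac⟩ := hspec
  refine ⟨N, a, h, hh, ha, hfac, fun b hb hb0 => ?_⟩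
  obtain ⟨h', hh', hfac'⟩ := exists_eq_sub_mul_of_eq_zero hh hb0
  have := hmax (N + 1) ⟨Function.update a N b, h', hh', ?_, ?_⟩
  · omega
  · intro i hi
    rcases eq_or_ne i N with rfl | hne
    · simpa using hb
    · rw [Function.update_of_ne hne]
      exact ha i (by omega)
  · intro z
    rw [hfac, hfac', Finset.prod_range_succ, Function.update_self, mul_assoc]
    congr 1
    refine Finset.prod_congr rfl fun i hi => ?_
    rw [Function.update_of_ne (Finset.mem_range.1 hi).ne]

lemma exists_eq_pow_mul {g : ℂ → ℂ} (hg : Differentiable ℂ g) (hne : ∃ z, g z ≠ 0) :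
    ∃ (k : ℕ) (h : ℂ → ℂ), Differentiable ℂ h ∧ h 0 ≠ 0 ∧ ∀ z, g z = z ^ k * h z := by
  have han : AnalyticAt ℂ g 0 := hg.analyticAt 0
  by_cases htop : analyticOrderAt g 0 = ⊤
  · exfalso
    rw [analyticOrderAt_eq_top] at htop
    obtain ⟨z, hz⟩ := hne
    have := (hg.differentiableOn.analyticOnNhd isOpen_univ).eqOn_zero_of_preconnected_of_eventuallyEq_zero
      isPreconnected_univ (Set.mem_univ 0) htop
    exact hz (this (Set.mem_univ z))
  · -- Split off factors `z` one after the other, as many as the order of vanishing at `0`.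
    obtain ⟨n, hn⟩ := ENat.ne_top_iff_exists.1 htop
    clear han htop hne
    induction n generalizing g with
    | zero =>
      refine ⟨0, g, hg, ?_, by simp⟩
      exact (hg.analyticAt 0).analyticOrderAt_eq_zero.1 (by simpa using hn.symm)
    | succ n ih =>
      have h0 : g 0 = 0 := by
        by_contra h
        rw [(hg.analyticAt 0).analyticOrderAt_eq_zero.2 h] at hn
        exact absurd hn (by norm_cast)
      obtain ⟨h, hh, hfac⟩ := exists_eq_sub_mul_of_eq_zero hg h0
      have hord : analyticOrderAt g 0 = 1 + analyticOrderAt h 0 := by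
        have : g = (fun z => z - 0) * h := by ext z; simpa using hfac z
        rw [this, analyticOrderAt_mul (by fun_prop) (hh.analyticAt 0)]
        congr 1
        simp only [sub_zero]
        refine ((by fun_prop : AnalyticAt ℂ (fun z : ℂ => z) 0).analyticOrderAt_eq_natCast
          (n := 1)).2 ⟨fun _ => 1, by fun_prop, by simp, by simp⟩
      have hn' : (n : ℕ∞) = analyticOrderAt h 0 := by
        rw [hord] at hn
        push_cast at hn
        exact (WithTop.add_right_inj ENat.one_ne_top).1 (by rwa [add_comm 1] at hn)
      obtain ⟨k, h', hh', h0', hfac'⟩ := ih hh hn'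
      refine ⟨k + 1, h', hh', h0', fun z => ?_⟩
      rw [hfac, hfac']; ring

/-- Zeros of an entire function in a closed disc can be split off as linear factors. -/
lemma exists_factorization_closedBall {g : ℂ → ℂ} (hg : Differentiable ℂ g)
    (hne : ∃ z, g z ≠ 0) {ρ : ℝ} (hρ : 0 < ρ) :
    ∃ (N : ℕ) (a : ℕ → ℂ) (h : ℂ → ℂ), Differentiable ℂ h ∧ (∀ i < N, ‖a i‖ ≤ ρ) ∧
      (∀ z, g z = (∏ i ∈ Finset.range N, (z - a i)) * h z) ∧ ∀ z, ‖z‖ ≤ ρ → h z ≠ 0 := by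
  obtain ⟨k, g₁, hg₁, h0, hfac⟩ := exists_eq_pow_mul hg hne
  obtain ⟨N, a, h, hh, ha, hfac', hz⟩ := exists_factorization_closedBall_of_ne_zero hg₁ h0 hρ
  refine ⟨N + k, fun i => if i < N then a i else 0, h, hh, fun i _ => ?_, fun z => ?_, hz⟩
  · dsimp only
    split_ifs with hi
    · exact ha i hi
    · simpa using hρ.le
  · rw [hfac, hfac', Finset.prod_range_add]
    have h1 : ∏ i ∈ Finset.range N, (z - if i < N then a i else 0)
        = ∏ i ∈ Finset.range N, (z - a i) :=
      Finset.prod_congr rfl fun i hi => by rw [if_pos (Finset.mem_range.1 hi)]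
    simp only [h1, add_lt_iff_neg_left, not_lt_zero, if_false, sub_zero, Finset.prod_const,
      Finset.card_range]
    ring

lemma countable_zeros {g : ℂ → ℂ} (hg : Differentiable ℂ g) (hne : ∃ z, g z ≠ 0) :
    {z | g z = 0}.Countable := by
  have hsub : {z | g z = 0} ⊆ ⋃ n : ℕ, {z | ‖z‖ ≤ (n : ℝ) + 1 ∧ g z = 0} := by
    intro z hz
    obtain ⟨n, hn⟩ := exists_nat_ge ‖z‖
    exact Set.mem_iUnion.2 ⟨n, by linarith, hz⟩
  refine Set.Countable.mono hsub (Set.countable_iUnion fun n => ?_)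
  obtain ⟨N, a, h, -, -, hfac, hz⟩ := exists_factorization_closedBall hg hne
    (by positivity : (0 : ℝ) < n + 1)
  refine ((Finset.range N).image a).finite_toSet.countable.mono ?_
  rintro z ⟨hzn, hz0⟩
  rw [hfac, mul_eq_zero, or_iff_left (hz z hzn), Finset.prod_eq_zero_iff] at hz0
  obtain ⟨i, hi, h0⟩ := hz0
  simp only [Finset.coe_image, Set.mem_image]
  exact ⟨i, hi, (sub_eq_zero.1 h0).symm⟩

/-! ### The Poisson–Jensen inequality -/

lemma circleIntegrable_log_norm_of_entire {g : ℂ → ℂ} (hg : Differentiable ℂ g) (R : ℝ) :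
    CircleIntegrable (fun z => log ‖g z‖) 0 R :=
  MeromorphicOn.circleIntegrable_log_norm fun z _ => (hg.analyticAt z).meromorphicAt

lemma circleIntegrable_posLog_norm_of_entire {g : ℂ → ℂ} (hg : Differentiable ℂ g) (R : ℝ) :
    CircleIntegrable (fun z => log⁺ ‖g z‖) 0 R :=
  MeromorphicOn.circleIntegrable_posLog_norm fun z _ => (hg.analyticAt z).meromorphicAt

lemma circleIntegrable_kernel_mul {R : ℝ} {w : ℂ} (hw : w ∈ ball (0 : ℂ) R) {u : ℂ → ℝ}
    (hu : CircleIntegrable u 0 R) :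
    CircleIntegrable (fun z => (herglotzRieszKernel 0 w z).re * u z) 0 R :=
  hu.continuousOn_mul (g := fun z => (herglotzRieszKernel 0 w z).re)
    (Complex.continuous_re.comp_continuousOn (continuousOn_herglotzRieszKernel_sphere hw))

/-- The Poisson integral of `log ‖g‖` equals `log ‖g w‖` if `g` has no zeros in the disc. -/
lemma poisson_log_norm_of_ne_zero {R : ℝ} {w : ℂ} (hw : w ∈ ball (0 : ℂ) R) {g : ℂ → ℂ}
    (hg : Differentiable ℂ g) (hz : ∀ z, ‖z‖ ≤ R → g z ≠ 0) :
    circleAverage (fun z => (herglotzRieszKernel 0 w z).re * log ‖g z‖) 0 R = log ‖g w‖ :=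
  InnerProductSpace.HarmonicOnNhd.circleAverage_re_herglotzRieszKernel_smul
    (f := fun z => log ‖g z‖) (c := 0) (R := R)
    (fun z hzR => (hg.analyticAt z).harmonicAt_log_norm (hz z (by simpa using hzR))) hw

/-- For a zero `a` inside the circle the reflected factor is zero-free and dominates `z - a`; for a
zero on the circle the Poisson formula still holds with equality. -/
lemma log_norm_sub_le_poisson {R : ℝ} {w : ℂ} (hw : w ∈ ball (0 : ℂ) R) {a : ℂ} (ha : ‖a‖ ≤ R)
    (hwa : w ≠ a) :
    log ‖w - a‖ ≤ circleAverage (fun z => (herglotzRieszKernel 0 w z).re * log ‖z - a‖) 0 R := by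
  have hR : 0 < R := pos_of_mem_ball hw
  rcases ha.eq_or_lt with hEq | hlt
  · refine le_of_eq (Eq.symm ?_)
    exact circleAverage_re_herglotzRieszKernel_mul_log (c := 0) (R := R)
      (by simpa using hEq) hw
  · set G : ℂ → ℂ := fun z => ((R : ℂ) ^ 2 - starRingEnd ℂ a * z) / R with hG
    have hGd : Differentiable ℂ G := by fun_prop
    have hGz : ∀ z, ‖z‖ ≤ R → G z ≠ 0 := by
      intro z hz h0
      have hR' : (R : ℂ) ≠ 0 := by exact_mod_cast hR.ne'
      rw [hG] at h0
      simp only [div_eq_zero_iff, hR', or_false, sub_eq_zero] at h0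
      have h1 := congrArg norm h0
      rw [norm_pow, norm_mul, RCLike.norm_conj, Complex.norm_real, Real.norm_eq_abs,
        abs_of_pos hR] at h1
      nlinarith [mul_le_mul_of_nonneg_left hz (norm_nonneg a)]
    have h1 := poisson_log_norm_of_ne_zero hw hGd hGz
    have h2 : circleAverage (fun z => (herglotzRieszKernel 0 w z).re * log ‖z - a‖) 0 R
        = circleAverage (fun z => (herglotzRieszKernel 0 w z).re * log ‖G z‖) 0 R := by
      refine circleAverage_congr_sphere fun z hz => ?_
      simp only [hG]
      rw [norm_reflected_factor hR a (by simpa [abs_of_pos hR] using hz)]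
    rw [h2, h1]
    refine log_le_log (norm_pos_iff.2 (sub_ne_zero.2 hwa)) ?_
    -- `z - a` is bounded by the zero-free factor on the circle, hence inside
    have hmax : ‖(w - a) / G w‖ ≤ 1 := by
      refine Complex.norm_le_of_forall_mem_frontier_norm_le (U := ball 0 R)
        (f := fun z => (z - a) / G z) isBounded_ball ?_ ?_ (subset_closure hw)
      · refine DifferentiableOn.diffContOnCl ?_
        rw [closure_ball _ hR.ne']
        intro z hz
        exact (DifferentiableAt.div (by fun_prop) (hGd z)
          (hGz z (by simpa using hz))).differentiableWithinAt
      · intro z hz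
        rw [frontier_ball _ hR.ne', mem_sphere_zero_iff_norm] at hz
        rw [norm_div, ← norm_reflected_factor hR a hz]
        exact div_self_le_one _
    rw [norm_div, div_le_one (norm_pos_iff.2 (hGz w (by simpa using (mem_ball.1 hw).le)))] at hmax
    exact hmax

/-- Poisson–Jensen inequality: the Poisson integral of `log ‖g‖` dominates `log ‖g w‖`. -/
lemma log_norm_le_poisson {R : ℝ} {w : ℂ} (hw : w ∈ ball (0 : ℂ) R) {g : ℂ → ℂ}
    (hg : Differentiable ℂ g) (hgw : g w ≠ 0) :
    log ‖g w‖ ≤ circleAverage (fun z => (herglotzRieszKernel 0 w z).re * log ‖g z‖) 0 R := by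
  have hR : 0 < R := pos_of_mem_ball hw
  obtain ⟨N, a, h, hh, ha, hfac, hz⟩ := exists_factorization_closedBall hg ⟨w, hgw⟩ hR
  have hwR : ‖w‖ ≤ R := by simpa using (mem_ball.1 hw).le
  have hwa : ∀ i ∈ Finset.range N, w - a i ≠ 0 := by
    intro i hi h0
    exact hgw (by rw [hfac, Finset.prod_eq_zero hi h0, zero_mul])
  have hlog : ∀ z, ‖z‖ ≤ R → (∀ i ∈ Finset.range N, z - a i ≠ 0) →
      log ‖g z‖ = (∑ i ∈ Finset.range N, log ‖z - a i‖) + log ‖h z‖ := by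
    intro z hzR hza
    rw [hfac, norm_mul, norm_prod, log_mul (Finset.prod_ne_zero_iff.2 fun i hi =>
      norm_ne_zero_iff.2 (hza i hi)) (norm_ne_zero_iff.2 (hz z hzR)),
      log_prod (fun i hi => norm_ne_zero_iff.2 (hza i hi))]
  have hint : ∀ i ∈ Finset.range N, CircleIntegrable
      (fun z => (herglotzRieszKernel 0 w z).re * log ‖z - a i‖) 0 R := fun i _ =>
    circleIntegrable_kernel_mul hw
      (circleIntegrable_log_norm_of_entire (g := fun z => z - a i) (by fun_prop) R)
  have hinth := circleIntegrable_kernel_mul hw (circleIntegrable_log_norm_of_entire hh R)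
  have heq : circleAverage (fun z => (herglotzRieszKernel 0 w z).re * log ‖g z‖) 0 R
      = (∑ i ∈ Finset.range N,
          circleAverage (fun z => (herglotzRieszKernel 0 w z).re * log ‖z - a i‖) 0 R)
        + circleAverage (fun z => (herglotzRieszKernel 0 w z).re * log ‖h z‖) 0 R := by
    rw [← circleAverage_fun_sum hint, ← circleAverage_fun_add (CircleIntegrable.fun_sum _ hint) hinth]
    refine circleAverage_congr_codiscreteWithin ?_ hR.ne'
    have hfin : ((Finset.range N).image a : Set ℂ).Finite := Finset.finite_toSet _
    have hcod : (((Finset.range N).image a : Finset ℂ) : Set ℂ)ᶜ ∈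
        codiscreteWithin (sphere (0 : ℂ) |R|) :=
      Filter.codiscreteWithin_mono (Set.subset_univ _) (Set.Finite.compl_mem_codiscrete hfin)
    filter_upwards [hcod, self_mem_codiscreteWithin _] with z hz1 hz2
    have hzR : ‖z‖ ≤ R := by
      rw [mem_sphere_zero_iff_norm, abs_of_pos hR] at hz2; exact hz2.le
    rw [hlog z hzR]
    · rw [mul_add, Finset.mul_sum]
    · intro i hi h0
      apply hz1
      simp only [Finset.coe_image, Set.mem_image]
      exact ⟨i, hi, (sub_eq_zero.1 h0).symm⟩
  rw [hlog w hwR hwa, heq, poisson_log_norm_of_ne_zero hw hh hz]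
  gcongr with i hi
  exact log_norm_sub_le_poisson hw (ha i (Finset.mem_range.1 hi)) (sub_ne_zero.1 (hwa i hi))

/-- The maximum modulus of an entire function is controlled by its proximity function on a larger
circle. -/
lemma log_norm_le_mul_circleAverage {R r : ℝ} (hr : 0 ≤ r) (hrR : r < R) {g : ℂ → ℂ}
    (hg : Differentiable ℂ g) {w : ℂ} (hw : ‖w‖ ≤ r) :
    log ‖g w‖ ≤ (R + r) / (R - r) * circleAverage (fun z => log⁺ ‖g z‖) 0 R := by
  have hR : 0 < R := hr.trans_lt hrR
  have havg : 0 ≤ circleAverage (fun z => log⁺ ‖g z‖) 0 R :=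
    circleAverage_nonneg_of_nonneg fun _ _ => posLog_nonneg
  by_cases hgw : g w = 0
  · rw [hgw, norm_zero, log_zero]
    exact mul_nonneg (div_nonneg (by linarith) (by linarith)) havg
  have hwb : w ∈ ball (0 : ℂ) R := by simpa using hw.trans_lt hrR
  refine (log_norm_le_poisson hwb hg hgw).trans ?_
  rw [← smul_eq_mul, ← circleAverage_fun_smul]
  refine circleAverage_mono (circleIntegrable_kernel_mul hwb
    (circleIntegrable_log_norm_of_entire hg R))
    ((circleIntegrable_posLog_norm_of_entire hg R).const_smul) fun z hz => ?_
  rw [abs_of_pos hR] at hz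
  have hup := re_herglotzRieszKernel_le hz hwb
  have hlow := le_re_herglotzRieszKernel hz hwb
  rw [← herglotzRieszKernel_def, sub_zero] at hup hlow
  have h0 : 0 ≤ (herglotzRieszKernel 0 w z).re :=
    le_trans (div_nonneg (by linarith) (by linarith [norm_nonneg w])) hlow
  have hup' : (herglotzRieszKernel 0 w z).re ≤ (R + r) / (R - r) :=
    hup.trans (by gcongr)
  rw [smul_eq_mul]
  refine (mul_le_mul_of_nonneg_left (?_ : log ‖g z‖ ≤ log⁺ ‖g z‖) h0).trans
    (mul_le_mul_of_nonneg_right hup' posLog_nonneg)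
  rw [posLog_apply]
  exact le_max_right _ _

/-! ### The lemma on the logarithmic derivative -/

/-- The distance of a point of the circle from `a` is at least linear in the angle between them,
wherever `a` lies relative to the circle. -/
lemma mul_abs_sub_le_norm_circleMap_sub {r : ℝ} (hr : 0 ≤ r) (a : ℂ) {t : ℝ}
    (ht : |t - a.arg| ≤ π) : r * |t - a.arg| / π ≤ ‖circleMap 0 r t - a‖ := by
  set φ := a.arg
  have ha : a = circleMap 0 ‖a‖ φ := by
    rw [circleMap_zero, Complex.norm_mul_exp_arg_mul_I]
  have h1 : ‖circleMap 0 r φ - a‖ ≤ ‖circleMap 0 r t - a‖ := by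
    have : circleMap 0 r φ - a = ((r - ‖a‖ : ℝ) : ℂ) * Complex.exp (φ * Complex.I) := by
      nth_rw 1 [ha]
      rw [circleMap_zero, circleMap_zero]
      push_cast; ring
    rw [this, norm_mul, Complex.norm_exp_ofReal_mul_I, mul_one, Complex.norm_real,
      Real.norm_eq_abs]
    have h := abs_norm_sub_norm_le (circleMap 0 r t) a
    rwa [norm_circleMap_zero, abs_of_nonneg hr] at h
  have h2 : ‖circleMap 0 r t - circleMap 0 r φ‖ = r * (2 * |sin ((t - φ) / 2)|) := by
    have : circleMap 0 r t - circleMap 0 r φ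
        = (r : ℂ) * Complex.exp (φ * Complex.I) *
          (Complex.exp (Complex.I * ((t - φ : ℝ) : ℂ)) - 1) := by
      rw [circleMap_zero, circleMap_zero, mul_sub, mul_assoc, ← Complex.exp_add]
      push_cast
      ring_nf
    rw [this, norm_mul, norm_mul, Complex.norm_exp_ofReal_mul_I, mul_one, Complex.norm_real,
      Real.norm_eq_abs, abs_of_nonneg hr, Complex.norm_exp_I_mul_ofReal_sub_one, norm_mul]
    simp
  have h3 : 2 / π * |(t - φ) / 2| ≤ |sin ((t - φ) / 2)| :=
    mul_abs_le_abs_sin (by rw [abs_div, abs_two]; linarith)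
  have h4 : ‖circleMap 0 r t - circleMap 0 r φ‖ ≤ 2 * ‖circleMap 0 r t - a‖ := by
    have := norm_sub_le (circleMap 0 r t - a) (circleMap 0 r φ - a)
    rw [sub_sub_sub_cancel_right] at this
    linarith
  rw [h2] at h4
  have h5 : |(t - φ) / 2| = |t - φ| / 2 := by rw [abs_div, abs_two]
  rw [h5] at h3
  have h6 : r * (2 * (2 / π * (|t - φ| / 2))) ≤ r * (2 * |sin ((t - φ) / 2)|) := by gcongr
  have h7 : r * (2 * (2 / π * (|t - φ| / 2))) = 2 * (r * |t - φ| / π) := by ring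
  linarith

lemma intervalIntegrable_abs_sub_rpow :
    IntervalIntegrable (fun θ : ℝ => (|θ - π| / π) ^ (-(1 / 2) : ℝ)) MeasureTheory.volume
      0 (2 * π) := by
  have h : IntervalIntegrable (fun x : ℝ => (x / π) ^ (-(1 / 2) : ℝ)) MeasureTheory.volume 0 π := by
    have h0 : IntervalIntegrable (fun x : ℝ => x ^ (-(1 / 2) : ℝ)) MeasureTheory.volume 0 π :=
      intervalIntegral.intervalIntegrable_rpow' (by norm_num)
    refine (h0.mul_const (π ^ (1 / 2 : ℝ))).congr fun x hx => ?_
    rw [Set.uIoc_of_le pi_pos.le] at hx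
    rw [div_rpow hx.1.le pi_pos.le, rpow_neg pi_pos.le, div_inv_eq_mul]
  have h1 := h.comp_sub_left π
  have h2 := h.comp_sub_right π
  rw [sub_zero, sub_self] at h1
  rw [zero_add, ← two_mul] at h2
  refine (h1.symm.congr fun x hx => ?_).trans (h2.congr fun x hx => ?_)
  · rw [Set.uIoc_of_le pi_pos.le] at hx
    rw [abs_sub_comm, abs_of_nonneg (by linarith [hx.2])]
  · rw [Set.uIoc_of_le (by linarith [pi_pos])] at hx
    rw [abs_of_nonneg (by linarith [hx.1])]

/-- The function `‖z - a‖ ^ (-1/2)` is integrable on circles, with averages bounded independently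
of `a` and of the radius `r ≥ 1`. -/
lemma exists_circleAverage_rpow_le : ∃ κ : ℝ, 0 ≤ κ ∧ ∀ (a : ℂ) (r : ℝ), 1 ≤ r →
    CircleIntegrable (fun z => ‖z - a‖ ^ (-(1 / 2) : ℝ)) 0 r ∧
    circleAverage (fun z => ‖z - a‖ ^ (-(1 / 2) : ℝ)) 0 r ≤ κ := by
  refine ⟨(2 * π)⁻¹ * ∫ θ in (0 : ℝ)..(2 * π), (|θ - π| / π) ^ (-(1 / 2) : ℝ), ?_, fun a r hr => ?_⟩
  · refine mul_nonneg (by positivity) (intervalIntegral.integral_nonneg (by positivity) ?_)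
    intro θ _
    positivity
  set G : ℝ → ℝ := fun θ => ‖circleMap 0 r θ - a‖ ^ (-(1 / 2) : ℝ) with hG
  have hper : Function.Periodic G (2 * π) := fun θ => by
    simp only [hG]; rw [periodic_circleMap]
  have hmeas : Measurable G := by
    have : Continuous fun θ => ‖circleMap 0 r θ - a‖ := by fun_prop
    exact this.measurable.pow_const _
  have hbound : ∀ θ ∈ Set.uIoc (0 : ℝ) (2 * π), θ ≠ π →
      G (θ + (a.arg - π)) ≤ (|θ - π| / π) ^ (-(1 / 2) : ℝ) := by
    intro θ hθ hne
    rw [Set.uIoc_of_le (by positivity)] at hθ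
    have habs : |θ - π| ≤ π := abs_le.2 ⟨by linarith [hθ.1], by linarith [hθ.2]⟩
    have heq : θ + (a.arg - π) - a.arg = θ - π := by ring
    have h1 := mul_abs_sub_le_norm_circleMap_sub (by linarith : 0 ≤ r) a
      (t := θ + (a.arg - π)) (by rw [heq]; exact habs)
    rw [heq] at h1
    have hpos : 0 < |θ - π| / π := div_pos (abs_pos.2 (sub_ne_zero.2 hne)) pi_pos
    refine rpow_le_rpow_of_nonpos hpos (le_trans ?_ h1) (by norm_num)
    rw [mul_div_assoc]
    exact le_mul_of_one_le_left hpos.le hr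
  have hae : ∀ᵐ θ ∂MeasureTheory.volume, θ ∈ Set.uIoc (0 : ℝ) (2 * π) →
      G (θ + (a.arg - π)) ≤ (|θ - π| / π) ^ (-(1 / 2) : ℝ) := by
    have : ∀ᵐ θ : ℝ ∂MeasureTheory.volume, θ ≠ π := by
      rw [MeasureTheory.ae_iff]; simp
    filter_upwards [this] with θ hne hθ
    exact hbound θ hθ hne
  have hnn : ∀ θ, 0 ≤ G θ := fun θ => by positivity
  have hint : IntervalIntegrable (fun θ => G (θ + (a.arg - π))) MeasureTheory.volume
      0 (2 * π) := by
    refine intervalIntegrable_abs_sub_rpow.mono_fun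
      (hmeas.comp (measurable_add_const _)).aestronglyMeasurable ?_
    rw [Filter.EventuallyLE, MeasureTheory.ae_restrict_iff' measurableSet_uIoc]
    filter_upwards [hae] with θ h hθ
    rw [Real.norm_of_nonneg (hnn _)]
    exact (h hθ).trans (le_abs_self _)
  have hint' : IntervalIntegrable G MeasureTheory.volume 0 (2 * π) := by
    have h := hint.comp_sub_right (a.arg - π)
    simp only [sub_add_cancel, zero_add] at h
    rw [add_comm (2 * π)] at h
    exact hper.intervalIntegrable (by positivity) h _ _
  refine ⟨hint', ?_⟩
  rw [circleAverage_eq_integral_add (a.arg - π), smul_eq_mul]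
  refine mul_le_mul_of_nonneg_left ?_ (by positivity)
  refine intervalIntegral.integral_mono_ae_restrict (by positivity) hint
    intervalIntegrable_abs_sub_rpow ?_
  rw [Filter.EventuallyLE, MeasureTheory.ae_restrict_iff' measurableSet_Icc]
  have h0 : ∀ᵐ θ : ℝ ∂MeasureTheory.volume, θ ≠ 0 := by
    rw [MeasureTheory.ae_iff]; simp
  filter_upwards [hae, h0] with θ h h0 hθ
  refine h ?_
  rw [Set.uIoc_of_le (by positivity)]
  exact ⟨lt_of_le_of_ne hθ.1 h0.symm, hθ.2⟩

/-- The logarithmic derivative of a zero-free function, by the Borel–Carathéodory theorem for its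
logarithm and Cauchy's estimate. -/
lemma norm_logDeriv_le_of_ne_zero {H : ℂ → ℂ} (hH : Differentiable ℂ H) {ρ r M : ℝ} (hr : 0 ≤ r)
    (hrρ : r < ρ) (hM : 0 < M) (hz : ∀ z, ‖z‖ < ρ → H z ≠ 0)
    (hle : ∀ z, ‖z‖ < ρ → log ‖H z‖ - log ‖H 0‖ ≤ M) {z : ℂ} (hzr : ‖z‖ ≤ r) :
    ‖logDeriv H z‖ ≤ 8 * M * ρ / (ρ - r) ^ 2 := by
  have hρ : 0 < ρ := hr.trans_lt hrρ
  have hd : DifferentiableOn ℂ (logDeriv H) (ball 0 ρ) := by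
    intro w hw
    exact ((hH.deriv w).div (hH w) (hz w (by simpa using hw))).differentiableWithinAt
  obtain ⟨l, hl0, hl⟩ := hd.isExactOn_ball.with_val_at 0 0
  have hexp : ∀ w ∈ ball (0 : ℂ) ρ, H w = H 0 * Complex.exp (l w) := by
    have hconst : ∀ w ∈ ball (0 : ℂ) ρ, H w * Complex.exp (-l w) = H 0 * Complex.exp (-l 0) := by
      intro w hw
      refine (convex_ball (0 : ℂ) ρ).is_const_of_fderivWithin_eq_zero (𝕜 := ℂ)
        (f := fun w => H w * Complex.exp (-l w)) ?_ ?_ hw (mem_ball_self hρ)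
      · intro w hw
        exact ((hH w).mul (hl w hw).differentiableAt.neg.cexp).differentiableWithinAt
      · intro w hw
        rw [fderivWithin_of_isOpen isOpen_ball hw]
        have h1 : HasDerivAt (fun w => H w * Complex.exp (-l w)) 0 w := by
          have h2 : deriv H w * Complex.exp (-l w)
              + H w * (Complex.exp (-l w) * -logDeriv H w) = 0 := by
            rw [logDeriv_apply]
            field_simp [hz w (by simpa using hw)]
            ring
          exact h2 ▸ (hH w).hasDerivAt.mul (hl w hw).neg.cexp
        ext
        simp [h1.hasFDerivAt.fderiv]
    intro w hw
    have := hconst w hw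
    rw [hl0, neg_zero, Complex.exp_zero, mul_one] at this
    rw [← this, mul_assoc, ← Complex.exp_add, neg_add_cancel, Complex.exp_zero, mul_one]
  have hmaps : Set.MapsTo l (ball 0 ρ) {z | z.re ≤ M} := by
    intro w hw
    have hw' : ‖w‖ < ρ := by simpa using hw
    have h1 := hle w hw'
    rw [hexp w hw, norm_mul, log_mul (norm_ne_zero_iff.2 (hz 0 (by simpa using hρ)))
      (by simp), Complex.norm_exp, log_exp] at h1
    simpa using h1
  have hld : DifferentiableOn ℂ l (ball 0 ρ) := fun w hw =>
    (hl w hw).differentiableAt.differentiableWithinAt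
  set s := (ρ - r) / 2 with hs
  have hs0 : 0 < s := by rw [hs]; linarith
  have hsub : closedBall z s ⊆ ball 0 ρ := by
    intro w hw
    have h1 : ‖w - z‖ ≤ s := by simpa [dist_eq_norm] using hw
    have h2 := norm_add_le (w - z) z
    rw [sub_add_cancel] at h2
    rw [mem_ball_zero_iff]
    linarith
  have hlb : ∀ w ∈ sphere z s, ‖l w‖ ≤ 2 * M * ρ / s := by
    intro w hw
    have hwb := hsub (sphere_subset_closedBall hw)
    refine (Complex.borelCaratheodory_zero hM hld hmaps hρ hwb hl0).trans ?_
    have h1 : ‖w - z‖ = s := by simpa [dist_eq_norm] using hw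
    have h2 := norm_add_le (w - z) z
    rw [sub_add_cancel] at h2
    have h3 : ‖w‖ ≤ ρ := by simpa using (mem_ball.1 hwb).le
    gcongr
    linarith
  have hC := Complex.norm_deriv_le_of_forall_mem_sphere_norm_le hs0
    (DifferentiableOn.diffContOnCl (by
      rw [closure_ball _ hs0.ne']; exact hld.mono hsub)) hlb
  have hzb : z ∈ ball (0 : ℂ) ρ := by simpa using hzr.trans_lt hrρ
  rw [(hl z hzb).deriv] at hC
  refine hC.trans (le_of_eq ?_)
  have : ρ - r ≠ 0 := by linarith
  rw [hs]
  field_simp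
  ring

/-- Bound for the logarithmic derivative in terms of the zeros in a slightly larger disc. -/
lemma norm_logDeriv_le_add_sum {g h : ℂ → ℂ} {N : ℕ} {a : ℕ → ℂ} {r ρ R B : ℝ} (hr : 0 ≤ r)
    (hrρ : r < ρ) (hρR : ρ < R) (hh : Differentiable ℂ h)
    (hfac : ∀ z, g z = (∏ i ∈ Finset.range N, (z - a i)) * h z) (ha : ∀ i < N, ‖a i‖ ≤ ρ)
    {z : ℂ} (hz : ‖z‖ ≤ r) (hgz : g z ≠ 0) (hB : ‖logDeriv (reflectZeros R N a h) z‖ ≤ B) :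
    ‖logDeriv g z‖ ≤ B + N / (R - r) + ∑ i ∈ Finset.range N, ‖z - a i‖⁻¹ := by
  have hR : 0 < R := by linarith
  have hRc : (R : ℂ) ≠ 0 := by exact_mod_cast hR.ne'
  have hza : ∀ i ∈ Finset.range N, z - a i ≠ 0 := by
    intro i hi h0
    exact hgz (by rw [hfac, Finset.prod_eq_zero hi h0, zero_mul])
  have hhz : h z ≠ 0 := fun h0 => hgz (by rw [hfac, h0, mul_zero])
  have hlow : ∀ i ∈ Finset.range N,
      R * (R - r) ≤ ‖(R : ℂ) ^ 2 - starRingEnd ℂ (a i) * z‖ := fun i hi =>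
    reflected_factor_lower_bound hρR.le (ha i (Finset.mem_range.1 hi)) hz
  have href : ∀ i ∈ Finset.range N, (R : ℂ) ^ 2 - starRingEnd ℂ (a i) * z ≠ 0 := by
    intro i hi h0
    have := hlow i hi
    rw [h0, norm_zero] at this
    have : 0 < R * (R - r) := mul_pos hR (by linarith)
    linarith
  have e1 : logDeriv g z = (∑ i ∈ Finset.range N, (z - a i)⁻¹) + logDeriv h z := by
    have : g = fun z => (∏ i ∈ Finset.range N, (z - a i)) * h z := funext hfac
    rw [this, logDeriv_mul z (Finset.prod_ne_zero_iff.2 hza) hhz (by fun_prop) (hh z),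
      logDeriv_prod hza (by fun_prop)]
    congr 1
    refine Finset.sum_congr rfl fun i _ => ?_
    simp [logDeriv_apply]
  have e2 : logDeriv (reflectZeros R N a h) z = (∑ i ∈ Finset.range N,
      -(starRingEnd ℂ (a i)) / ((R : ℂ) ^ 2 - starRingEnd ℂ (a i) * z)) + logDeriv h z := by
    have hne : ∀ i ∈ Finset.range N, ((R : ℂ) ^ 2 - starRingEnd ℂ (a i) * z) / R ≠ 0 :=
      fun i hi => div_ne_zero (href i hi) hRc
    unfold reflectZeros
    rw [logDeriv_mul z (Finset.prod_ne_zero_iff.2 hne) hhz (by fun_prop) (hh z),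
      logDeriv_prod (f := fun i z => ((R : ℂ) ^ 2 - starRingEnd ℂ (a i) * z) / R) hne
        (by fun_prop)]
    congr 1
    refine Finset.sum_congr rfl fun i hi => ?_
    have hd : HasDerivAt (fun z : ℂ => ((R : ℂ) ^ 2 - starRingEnd ℂ (a i) * z) / R)
        (-(starRingEnd ℂ (a i)) / R) z := by
      have := (((hasDerivAt_id z).const_mul (starRingEnd ℂ (a i))).const_sub ((R : ℂ) ^ 2)).div_const
        (R : ℂ)
      simpa using this
    rw [logDeriv_apply, hd.deriv]
    field_simp
  have e3 : logDeriv g z = logDeriv (reflectZeros R N a h) z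
      + (∑ i ∈ Finset.range N, starRingEnd ℂ (a i) / ((R : ℂ) ^ 2 - starRingEnd ℂ (a i) * z))
      + ∑ i ∈ Finset.range N, (z - a i)⁻¹ := by
    rw [e1, e2]
    simp only [neg_div, Finset.sum_neg_distrib]
    ring
  rw [e3]
  refine (norm_add_le _ _).trans (add_le_add ((norm_add_le _ _).trans (add_le_add hB ?_)) ?_)
  · refine (norm_sum_le _ _).trans ?_
    have : (N : ℝ) / (R - r) = ∑ _i ∈ Finset.range N, 1 / (R - r) := by
      simp [div_eq_mul_inv]
    rw [this]
    refine Finset.sum_le_sum fun i hi => ?_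
    have hRr : 0 < R - r := by linarith
    rw [norm_div, RCLike.norm_conj, div_le_div_iff₀ (norm_pos_iff.2 (href i hi)) hRr, one_mul]
    refine le_trans ?_ (hlow i hi)
    have := ha i (Finset.mem_range.1 hi)
    gcongr
    linarith
  · refine (norm_sum_le _ _).trans (le_of_eq ?_)
    simp only [norm_inv]

/-- A form of Jensen's inequality for the concave function `log`, proved by replacing `log` by its
tangent line at `1 + A + B`. -/
lemma circleAverage_posLog_le_of_le_sq {u Y : ℂ → ℝ} {r A B : ℝ} (hr : 0 < r) (hA : 0 ≤ A)
    (hB : 0 ≤ B) (hu : ∀ z, 0 ≤ u z) (hY : ∀ z, 0 ≤ Y z)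
    (hle : ∀ z, ‖z‖ = r → u z ≤ (1 + A + Y z) ^ 2)
    (hui : CircleIntegrable (fun z => log⁺ (u z)) 0 r) (hYi : CircleIntegrable Y 0 r)
    (hYB : circleAverage Y 0 r ≤ B) :
    circleAverage (fun z => log⁺ (u z)) 0 r ≤ 2 * log (1 + A + B) := by
  set s := 1 + A + B with hs
  have hs0 : 0 < s := by positivity
  have hcI : CircleIntegrable (fun _ : ℂ => 2 * (log s + (1 + A) / s - 1)) 0 r :=
    circleIntegrable_const _ _ _
  have hYi' : CircleIntegrable (fun z => (2 / s) • Y z) 0 r := hYi.const_smul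
  have h1 : circleAverage (fun z => log⁺ (u z)) 0 r ≤
      circleAverage (fun z => 2 * (log s + (1 + A) / s - 1) + (2 / s) • Y z) 0 r := by
    refine circleAverage_mono hui (hcI.fun_add hYi') fun z hz => ?_
    have hz' : ‖z‖ = r := by simpa [abs_of_pos hr] using hz
    have hpos : 0 < 1 + A + Y z := by linarith [hY z]
    have e1 := posLog_le_posLog (hu z) (hle z hz')
    have e0 : log⁺ (1 + A + Y z) = log (1 + A + Y z) :=
      posLog_eq_log (by rw [abs_of_pos hpos]; linarith [hY z])
    rw [posLog_pow, e0] at e1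
    have e2 := log_le_sub_one_of_pos (div_pos hpos hs0)
    rw [log_div hpos.ne' hs0.ne'] at e2
    have e3 : (1 + A + Y z) / s = (1 + A) / s + Y z / s := by ring
    have e4 : (2 / s) • Y z = 2 * (Y z / s) := by rw [smul_eq_mul]; ring
    push_cast at e1
    rw [e4]
    linarith
  rw [circleAverage_fun_add hcI hYi', circleAverage_const,
    circleAverage_fun_smul, smul_eq_mul] at h1
  have h2 : 2 / s * circleAverage Y 0 r ≤ 2 / s * B := by gcongr
  have h3 : 2 * ((1 + A) / s) + 2 / s * B = 2 := by
    have : s ≠ 0 := hs0.ne'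
    field_simp
    rw [hs]
  linarith

/-- The size, in terms of `r`, `δ` and `L`, of the bound that averaging the pointwise estimate of a
logarithmic derivative produces; `N` is the number of zeros and `c` comes from the value at `0`. -/
lemma log_zero_sum_le {κ c r δ L N : ℝ} (hκ : 0 ≤ κ) (hc : 0 ≤ c) (hr : 1 ≤ r)
    (hδ : 0 < δ) (hδ1 : δ ≤ 1) (hL : 1 ≤ L) (hN0 : 0 ≤ N)
    (hN : N ≤ 4 * r * (L + c) / δ) :
    log (1 + 68 * r * (L + c) / δ ^ 2 + N * κ) ≤
      log (69 + 4 * κ) + log (1 + c) + log L + log r - 2 * log δ := by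
  have hpos : 0 < 1 + 68 * r * (L + c) / δ ^ 2 + N * κ := by positivity
  have hd2 : δ ^ 2 ≤ 1 := pow_le_one₀ hδ.le hδ1
  have hML : L + c ≤ (1 + c) * L := by nlinarith
  set T := r * (L + c) / δ ^ 2 with hT
  have e1 : 1 ≤ T := by
    rw [hT, one_le_div (by positivity)]
    nlinarith
  have e2 : N * κ ≤ 4 * κ * T := by
    have h4 : 4 * r * (L + c) / δ ≤ 4 * T := by
      rw [hT, mul_div_assoc', ← mul_assoc]
      gcongr
      nlinarith
    have : N ≤ 4 * T := hN.trans h4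
    nlinarith
  have e3 : 1 + 68 * r * (L + c) / δ ^ 2 + N * κ ≤ (69 + 4 * κ) * ((1 + c) * L * r / δ ^ 2) :=
    calc 1 + 68 * r * (L + c) / δ ^ 2 + N * κ ≤ (69 + 4 * κ) * T := by
          have : 68 * r * (L + c) / δ ^ 2 = 68 * T := by rw [hT]; ring
          rw [this]; linarith
      _ ≤ (69 + 4 * κ) * (r * ((1 + c) * L) / δ ^ 2) := by rw [hT]; gcongr
      _ = _ := by ring
  refine (log_le_log hpos e3).trans (le_of_eq ?_)
  rw [log_mul (by positivity) (by positivity), log_div (by positivity) (by positivity),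
    log_mul (by positivity) (by positivity), log_mul (by positivity) (by positivity), log_pow]
  push_cast; ring

/-- The lemma on the logarithmic derivative for an entire function with `g 0 ≠ 0`, in terms of a
bound for `log ‖g‖` on a disc of radius `r + δ`. -/
lemma exists_circleAverage_posLog_logDeriv_le_of_ne_zero {g : ℂ → ℂ} (hg : Differentiable ℂ g)
    (hg0 : g 0 ≠ 0) : ∃ K : ℝ, 0 ≤ K ∧ ∀ r δ L : ℝ, 1 ≤ r → 0 < δ → δ ≤ 1 → 1 ≤ L →
      (∀ z, ‖z‖ ≤ r + δ → ‖g z‖ ≤ exp L) →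
      circleAverage (fun z => log⁺ ‖logDeriv g z‖) 0 r ≤ K * (1 + log r - log δ + log L) := by
  obtain ⟨κ, hκ, hκa⟩ := exists_circleAverage_rpow_le
  set c := |log ‖g 0‖| with hc
  have hc0 : 0 ≤ c := abs_nonneg _
  have hlog1 : 0 ≤ log (69 + 4 * κ) := log_nonneg (by linarith)
  have hlog2 : 0 ≤ log (1 + c) := log_nonneg (by linarith)
  refine ⟨2 * (log (69 + 4 * κ) + log (1 + c) + 2), by positivity,
    fun r δ L hr hδ hδ1 hL hbd => ?_⟩
  set R := r + δ with hR
  set ρ := r + δ / 2 with hρ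
  set M := L + c with hM
  have hM1 : 1 ≤ M := by linarith
  obtain ⟨N, a, h, hh, ha, hfac, hz⟩ :=
    exists_factorization_closedBall_of_ne_zero hg hg0 (by positivity : 0 < ρ)
  set H := reflectZeros R N a h with hHdef
  have hHd : Differentiable ℂ H := differentiable_reflectZeros hh
  have hρR : ρ < R := by linarith
  have hHle : ∀ z, ‖z‖ ≤ R → ‖H z‖ ≤ exp L := fun z hzR =>
    norm_reflectZeros_le (by linarith) hh hfac hbd hzR
  have hg0' : 0 < ‖g 0‖ := norm_pos_iff.2 hg0
  have hcount := norm_le_norm_reflectZeros_zero (by linarith) hρR.le hfac ha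
  -- the number of zeros in the disc of radius `ρ`
  have hq : 1 < R / ρ := (one_lt_div (by linarith)).2 hρR
  have hN : (N : ℝ) ≤ 4 * r * M / δ := by
    have h1 : log (‖g 0‖ * (R / ρ) ^ N) ≤ L := by
      rw [← log_exp L]
      refine log_le_log (by positivity) (hcount.trans (hHle 0 (by simp; linarith)))
    rw [log_mul hg0'.ne' (by positivity), log_pow] at h1
    have h2 : (N : ℝ) * log (R / ρ) ≤ M := by linarith [neg_abs_le (log ‖g 0‖)]
    have h3 : δ / (4 * r) ≤ log (R / ρ) := by
      refine le_trans ?_ (one_sub_inv_le_log_of_pos (by linarith))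
      rw [inv_div, one_sub_div (by linarith), div_le_div_iff₀ (by linarith) (by linarith)]
      have : R - ρ = δ / 2 := by rw [hR, hρ]; ring
      rw [this]
      nlinarith
    have h4 : (N : ℝ) * (δ / (4 * r)) ≤ M := le_trans (by gcongr) h2
    rw [le_div_iff₀ hδ]
    have : (N : ℝ) * (δ / (4 * r)) * (4 * r) = N * δ := by field_simp
    nlinarith
  -- the zero-free part
  have hHz : ∀ z, ‖z‖ < ρ → H z ≠ 0 := by
    intro z hzρ h0
    rw [hHdef, reflectZeros, mul_eq_zero, or_iff_left (hz z hzρ.le),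
      Finset.prod_eq_zero_iff] at h0
    obtain ⟨i, hi, h0⟩ := h0
    have h1 := reflected_factor_lower_bound hρR.le (ha i (Finset.mem_range.1 hi)) hzρ.le
    have hRc : (R : ℂ) ≠ 0 := by
      have : R ≠ 0 := by linarith
      exact_mod_cast this
    rw [(div_eq_zero_iff.1 h0).resolve_right hRc, norm_zero] at h1
    nlinarith
  have hH0 : ‖g 0‖ ≤ ‖H 0‖ := by
    refine le_trans ?_ hcount
    exact le_mul_of_one_le_right hg0'.le (one_le_pow₀ hq.le)
  have hlogH : ∀ z, ‖z‖ < ρ → log ‖H z‖ - log ‖H 0‖ ≤ M := by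
    intro z hzρ
    have h1 : log ‖H z‖ ≤ L := by
      rw [← log_exp L]
      exact log_le_log (norm_pos_iff.2 (hHz z hzρ)) (hHle z (hzρ.trans hρR).le)
    have h2 : log ‖g 0‖ ≤ log ‖H 0‖ := log_le_log hg0' hH0
    linarith [neg_abs_le (log ‖g 0‖)]
  set A := 68 * r * M / δ ^ 2 with hA
  have hA0 : 0 ≤ A := by positivity
  -- The exponent `-1/2` makes `Y` integrable over circles through zeros, where `‖z - a i‖⁻¹` is not;
  -- after taking logarithms the square root costs only a factor `2`.
  set Y : ℂ → ℝ := fun z => ∑ i ∈ Finset.range N, ‖z - a i‖ ^ (-(1 / 2) : ℝ) with hY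
  have hY0 : ∀ z, 0 ≤ Y z := fun z => Finset.sum_nonneg fun i _ => by positivity
  have hpt : ∀ z, ‖z‖ = r → ‖logDeriv g z‖ ≤ (1 + A + Y z) ^ 2 := by
    intro z hzr
    by_cases hgz : g z = 0
    · rw [logDeriv_apply, hgz, div_zero, norm_zero]
      positivity
    have h1 := norm_logDeriv_le_of_ne_zero hHd (by linarith) (by linarith : r < ρ)
      (by linarith : 0 < M) hHz hlogH hzr.le
    have h2 : 8 * M * ρ / (ρ - r) ^ 2 ≤ 64 * r * M / δ ^ 2 := by
      have e1 : ρ - r = δ / 2 := by rw [hρ]; ring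
      have e2 : 8 * M * ρ / (δ / 2) ^ 2 = 32 * ρ * M / δ ^ 2 := by field_simp; ring
      rw [e1, e2]
      gcongr ?_ * M / δ ^ 2
      linarith
    have h3 := norm_logDeriv_le_add_sum (by linarith) (by linarith : r < ρ) hρR hh hfac ha hzr.le
      hgz (h1.trans h2)
    have h4 : (N : ℝ) / (R - r) ≤ 4 * r * M / δ ^ 2 := by
      have e1 : R - r = δ := by rw [hR]; ring
      rw [e1, pow_two, ← div_div]
      gcongr
    have h5 : ∑ i ∈ Finset.range N, ‖z - a i‖⁻¹ ≤ Y z ^ 2 := by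
      have : ∀ i ∈ Finset.range N, ‖z - a i‖⁻¹ = (‖z - a i‖ ^ (-(1 / 2) : ℝ)) ^ 2 := by
        intro i _
        rw [← rpow_natCast, ← rpow_mul (norm_nonneg _)]
        norm_num [rpow_neg_one]
      rw [Finset.sum_congr rfl this]
      exact Finset.sum_sq_le_sq_sum_of_nonneg fun i _ => by positivity
    have h6 : 64 * r * M / δ ^ 2 + 4 * r * M / δ ^ 2 = A := by rw [hA]; ring
    nlinarith [hY0 z]
  -- averaging: the zeros contribute at most `κ` each to the average of `Y`
  set s := 1 + A + N * κ with hs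
  have hYint : CircleIntegrable Y 0 r :=
    CircleIntegrable.fun_sum _ fun i _ => (hκa (a i) r hr).1
  have hYavg : circleAverage Y 0 r ≤ N * κ := by
    rw [hY, circleAverage_fun_sum fun i _ => (hκa (a i) r hr).1]
    refine (Finset.sum_le_sum fun i _ => (hκa (a i) r hr).2).trans (le_of_eq ?_)
    simp
  have hmer : CircleIntegrable (fun z => log⁺ ‖logDeriv g z‖) 0 r :=
    MeromorphicOn.circleIntegrable_posLog_norm fun z _ =>
      (hg.analyticAt z).meromorphicAt.logDeriv
  have havg : circleAverage (fun z => log⁺ ‖logDeriv g z‖) 0 r ≤ 2 * log s :=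
    circleAverage_posLog_le_of_le_sq (by linarith) hA0 (by positivity) (fun z => norm_nonneg _) hY0
      hpt hmer hYint hYavg
  have hlogs : log s ≤ log (69 + 4 * κ) + log (1 + c) + log L + log r - 2 * log δ :=
    log_zero_sum_le hκ hc0 hr hδ hδ1 hL (Nat.cast_nonneg _) hN
  have hr0 : 0 ≤ log r := log_nonneg hr
  have hd0 : log δ ≤ 0 := log_nonpos hδ.le hδ1
  have hL0 : 0 ≤ log L := log_nonneg hL
  refine havg.trans ?_
  have hK : 0 ≤ log (69 + 4 * κ) + log (1 + c) := by positivity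
  nlinarith [mul_nonneg hK (by linarith : 0 ≤ log r - log δ + log L)]

/-- The lemma on the logarithmic derivative for entire functions. -/
lemma exists_circleAverage_posLog_logDeriv_le {g : ℂ → ℂ} (hg : Differentiable ℂ g)
    (hne : ∃ z, g z ≠ 0) : ∃ K : ℝ, 0 ≤ K ∧ ∀ r δ L : ℝ, 1 ≤ r → 0 < δ → δ ≤ 1 → 1 ≤ L →
      (∀ z, ‖z‖ ≤ r + δ → ‖g z‖ ≤ exp L) →
      circleAverage (fun z => log⁺ ‖logDeriv g z‖) 0 r ≤ K * (1 + log r - log δ + log L) := by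
  obtain ⟨k, h, hh, h0, hfac⟩ := exists_eq_pow_mul hg hne
  obtain ⟨K, hK0, hK⟩ := exists_circleAverage_posLog_logDeriv_le_of_ne_zero hh h0
  have hk0 : 0 ≤ log⁺ (k : ℝ) := posLog_nonneg
  refine ⟨K + (log 2 + log⁺ (k : ℝ)), by positivity, fun r δ L hr hδ hδ1 hL hbd => ?_⟩
  have hhbd : ∀ z, ‖z‖ ≤ r + δ → ‖h z‖ ≤ exp L := by
    intro z hz
    refine Complex.norm_le_of_forall_mem_frontier_norm_le (U := ball 0 (r + δ)) isBounded_ball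
      hh.diffContOnCl ?_ ?_
    · intro w hw
      rw [frontier_ball _ (by linarith), mem_sphere_zero_iff_norm] at hw
      refine le_trans ?_ (hbd w hw.le)
      rw [hfac, norm_mul, norm_pow, hw]
      exact le_mul_of_one_le_left (norm_nonneg _) (one_le_pow₀ (by linarith))
    · rw [closure_ball _ (by linarith)]
      simpa using hz
  have hbase := hK r δ L hr hδ hδ1 hL hhbd
  have hmerg : CircleIntegrable (fun z => log⁺ ‖logDeriv g z‖) 0 r :=
    MeromorphicOn.circleIntegrable_posLog_norm fun z _ =>
      (hg.analyticAt z).meromorphicAt.logDeriv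
  have hmerh : CircleIntegrable (fun z => log⁺ ‖logDeriv h z‖) 0 r :=
    MeromorphicOn.circleIntegrable_posLog_norm fun z _ =>
      (hh.analyticAt z).meromorphicAt.logDeriv
  have hcI : CircleIntegrable (fun _ : ℂ => log 2 + log⁺ (k : ℝ)) 0 r :=
    circleIntegrable_const _ _ _
  have h1 : circleAverage (fun z => log⁺ ‖logDeriv g z‖) 0 r ≤
      circleAverage (fun z => log⁺ ‖logDeriv h z‖ + (log 2 + log⁺ (k : ℝ))) 0 r := by
    refine circleAverage_mono hmerg (hmerh.fun_add hcI) fun z hz => ?_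
    have hz' : ‖z‖ = r := by simpa [abs_of_pos (by linarith : 0 < r)] using hz
    have hz0 : z ≠ 0 := by
      rintro rfl
      rw [norm_zero] at hz'
      linarith
    by_cases hhz : h z = 0
    · rw [logDeriv_apply, hfac, hhz, mul_zero, div_zero, norm_zero, posLog_zero]
      have : 0 ≤ log⁺ ‖logDeriv h z‖ := posLog_nonneg
      positivity
    · have e1 : logDeriv g z = logDeriv h z + k / z := by
        have : g = fun z => z ^ k * h z := funext hfac
        rw [this, logDeriv_mul (f := fun z => z ^ k) z (pow_ne_zero _ hz0) hhz (by fun_prop) (hh z)]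
        simp only [logDeriv_apply, deriv_pow_field]
        rw [add_comm]
        congr 1
        rcases k with _ | k
        · simp
        · simp only [Nat.add_sub_cancel]
          field_simp
          ring
      have e2 : ‖(k : ℂ) / z‖ ≤ (k : ℝ) := by
        rw [norm_div, hz', Complex.norm_natCast]
        exact div_le_self (by positivity) hr
      rw [e1]
      have e3 := posLog_norm_add_le (logDeriv h z) ((k : ℂ) / z)
      have e4 := posLog_le_posLog (norm_nonneg _) e2
      linarith
  rw [circleAverage_fun_add hmerh hcI, circleAverage_const] at h1
  have hr0 : 0 ≤ log r := log_nonneg hr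
  have hd0 : log δ ≤ 0 := log_nonpos hδ.le hδ1
  have hL0 : 0 ≤ log L := log_nonneg hL
  have hlog2 : 0 ≤ log 2 := log_nonneg one_le_two
  nlinarith [mul_nonneg (add_nonneg hlog2 hk0) (by linarith : 0 ≤ log r - log δ + log L)]

/-! ### Functions that are small compared with an entire function -/

/-- The data of an estimate: radii `1 ≤ r < r + δ ≤ r + 1` and a bound `exp L`, with `1 ≤ L`, for
the modulus of `f` on the disc of radius `r + δ`. -/
structure DiscBound (f : ℂ → ℂ) (r δ L : ℝ) : Prop where
  one_le_radius : 1 ≤ r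
  pos : 0 < δ
  le_one : δ ≤ 1
  one_le_bound : 1 ≤ L
  norm_le : ∀ z, ‖z‖ ≤ r + δ → ‖f z‖ ≤ exp L

/-- The growth of `g` is controlled by that of `f`: a bound `exp L` for `f` gives a bound for `g` on
a slightly smaller disc, with exponent linear in `L` up to logarithms of the radii. -/
def GrowthControlled (f g : ℂ → ℂ) : Prop :=
  ∃ K : ℝ, 0 ≤ K ∧ ∀ r δ L : ℝ, DiscBound f r δ L →
    ∀ z, ‖z‖ ≤ r + δ / 2 → ‖g z‖ ≤ exp (K * (L * (1 + log r - log δ)))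

/-- The proximity function of `E` is small compared with that of `f`: a bound `exp L` for `f`
gives a bound for the average of `log⁺ E` that is only logarithmic in `L`. These are the functions
with `m(r, E) = S(r, f)` in the notation of Nevanlinna theory. -/
def ProximitySmall (f : ℂ → ℂ) (E : ℂ → ℝ) : Prop :=
  Measurable E ∧ ∃ K : ℝ, 0 ≤ K ∧ ∀ r δ L : ℝ, DiscBound f r δ L →
    CircleIntegrable (fun z => log⁺ (E z)) 0 r ∧
    circleAverage (fun z => log⁺ (E z)) 0 r ≤ K * (1 + log r - log δ + log L)

namespace DiscBound

variable {f : ℂ → ℂ} {r δ L : ℝ}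

lemma log_radius_nonneg (h : DiscBound f r δ L) : 0 ≤ log r := log_nonneg h.one_le_radius

lemma log_pos_nonpos (h : DiscBound f r δ L) : log δ ≤ 0 := log_nonpos h.pos.le h.le_one

lemma log_bound_nonneg (h : DiscBound f r δ L) : 0 ≤ log L := log_nonneg h.one_le_bound

lemma one_le_logs (h : DiscBound f r δ L) : 1 ≤ 1 + log r - log δ := by
  linarith [h.log_radius_nonneg, h.log_pos_nonpos]

lemma one_le_product (h : DiscBound f r δ L) : 1 ≤ L * (1 + log r - log δ) :=
  one_le_mul_of_one_le_of_one_le h.one_le_bound h.one_le_logs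

lemma one_le_total (h : DiscBound f r δ L) : 1 ≤ 1 + log r - log δ + log L := by
  linarith [h.one_le_logs, h.log_bound_nonneg]

end DiscBound

namespace GrowthControlled

variable {f g h : ℂ → ℂ}

lemma const (c : ℂ) : GrowthControlled f fun _ => c := by
  refine ⟨log⁺ ‖c‖, posLog_nonneg, fun r δ L hb z _ => ?_⟩
  have h1 : log⁺ ‖c‖ ≤ log⁺ ‖c‖ * (L * (1 + log r - log δ)) :=
    le_mul_of_one_le_right posLog_nonneg hb.one_le_product
  refine le_trans ?_ (exp_le_exp.2 h1)
  rw [posLog_eq_log_max_one (norm_nonneg _), exp_log (by positivity)]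
  exact le_max_right _ _

lemma id : GrowthControlled f fun z => z := by
  refine ⟨1 + log 2, by positivity, fun r δ L hb z hz => ?_⟩
  have hr := hb.one_le_radius
  have h1 : ‖z‖ ≤ 2 * r := by linarith [hb.le_one]
  refine h1.trans ?_
  rw [← exp_log (by linarith : (0 : ℝ) < 2 * r), exp_le_exp, log_mul (by norm_num) (by linarith)]
  have h2 : 0 ≤ log 2 := log_nonneg one_le_two
  have h3 : log r ≤ L * (1 + log r - log δ) := by
    have := mul_le_mul_of_nonneg_right hb.one_le_bound
      (by linarith [hb.one_le_logs] : 0 ≤ 1 + log r - log δ)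
    linarith [hb.log_pos_nonpos]
  have h4 := mul_le_mul_of_nonneg_left hb.one_le_product h2
  linarith

lemma mul (hg : GrowthControlled f g) (hh : GrowthControlled f h) :
    GrowthControlled f fun z => g z * h z := by
  obtain ⟨K, hK, hK'⟩ := hg
  obtain ⟨J, hJ, hJ'⟩ := hh
  refine ⟨K + J, by positivity, fun r δ L hb z hz => ?_⟩
  rw [norm_mul, add_mul, exp_add]
  exact mul_le_mul (hK' r δ L hb z hz) (hJ' r δ L hb z hz) (norm_nonneg _) (exp_pos _).le

lemma add (hg : GrowthControlled f g) (hh : GrowthControlled f h) :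
    GrowthControlled f fun z => g z + h z := by
  obtain ⟨K, hK, hK'⟩ := hg
  obtain ⟨J, hJ, hJ'⟩ := hh
  refine ⟨log 2 + K + J, by positivity, fun r δ L hb z hz => ?_⟩
  have h0 := hb.one_le_product
  set P := L * (1 + log r - log δ)
  have h1 := hK' r δ L hb z hz
  have h2 := hJ' r δ L hb z hz
  have h3 : exp (K * P) ≤ exp (K * P + J * P) := exp_le_exp.2 (by nlinarith)
  have h4 : exp (J * P) ≤ exp (K * P + J * P) := exp_le_exp.2 (by nlinarith)
  have h5 : 2 * exp (K * P + J * P) ≤ exp ((log 2 + K + J) * P) := by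
    have : (2 : ℝ) = exp (log 2) := (exp_log two_pos).symm
    nth_rw 1 [this]
    rw [← exp_add, exp_le_exp]
    nlinarith [log_nonneg one_le_two]
  linarith [norm_add_le (g z) (h z)]

lemma neg (hg : GrowthControlled f g) : GrowthControlled f fun z => -g z := by
  simpa using (const (f := f) (-1)).mul hg

lemma sub (hg : GrowthControlled f g) (hh : GrowthControlled f h) :
    GrowthControlled f fun z => g z - h z := by
  simpa [sub_eq_add_neg] using hg.add hh.neg

lemma pow (hg : GrowthControlled f g) (n : ℕ) : GrowthControlled f fun z => g z ^ n := by
  induction n with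
  | zero => simpa using const (f := f) 1
  | succ n ih => simpa only [pow_succ] using ih.mul hg

lemma polynomial (p : Polynomial ℂ) : GrowthControlled f fun z => p.eval z := by
  induction p using Polynomial.induction_on' with
  | add p q hp hq => simpa only [Polynomial.eval_add] using hp.add hq
  | monomial n a => simpa only [Polynomial.eval_monomial] using (const a).mul (id.pow n)

/-- Cauchy's estimate: the derivatives of `f` are controlled by `f`. -/
lemma iteratedDeriv (hf : Differentiable ℂ f) (k : ℕ) :
    GrowthControlled f (iteratedDeriv k f) := by
  have hfac : 0 ≤ log (k.factorial : ℝ) := log_natCast_nonneg _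
  have h2 : 0 ≤ log 2 := log_nonneg one_le_two
  refine ⟨log k.factorial + 1 + k * (1 + log 2), by positivity, fun r δ L hb z hz => ?_⟩
  have hδ := hb.pos
  have hC := Complex.norm_iteratedDeriv_le_of_forall_mem_sphere_norm_le (c := z) (R := δ / 2)
    (C := exp L) k (by positivity) hf.diffContOnCl ?_
  · refine hC.trans ?_
    have hk : (k.factorial : ℝ) = exp (log k.factorial) :=
      (exp_log (by exact_mod_cast k.factorial_pos)).symm
    have hd : (δ / 2) ^ k = exp (k * (log δ - log 2)) := by
      rw [← log_div hδ.ne' two_ne_zero, exp_nat_mul, exp_log (by positivity)]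
    rw [hd]
    nth_rw 1 [hk]
    rw [← exp_add, ← exp_sub, exp_le_exp]
    have h0 := hb.one_le_product
    have h1 : 1 + log r - log δ ≤ L * (1 + log r - log δ) :=
      le_mul_of_one_le_left (by linarith [hb.one_le_logs]) hb.one_le_bound
    have h3 : L ≤ L * (1 + log r - log δ) :=
      le_mul_of_one_le_right (by linarith [hb.one_le_bound]) hb.one_le_logs
    set P := L * (1 + log r - log δ)
    have e1 : log (k.factorial : ℝ) ≤ log k.factorial * P := le_mul_of_one_le_right hfac h0
    have e2 : log 2 ≤ log 2 * P := le_mul_of_one_le_right h2 h0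
    have e3 : -log δ ≤ P := by linarith [hb.log_radius_nonneg]
    have e4 : (k : ℝ) * (log 2 - log δ) ≤ k * ((1 + log 2) * P) := by
      gcongr
      linarith
    nlinarith
  · intro w hw
    refine hb.norm_le w ?_
    have h1 : ‖w - z‖ = δ / 2 := by simpa [dist_eq_norm] using hw
    have h2 := norm_add_le (w - z) z
    rw [sub_add_cancel] at h2
    linarith

end GrowthControlled

lemma ae_circleMap_notMem_of_countable {S : Set ℂ} (hS : S.Countable) {r : ℝ} (hr : r ≠ 0) :
    ∀ᵐ θ ∂MeasureTheory.volume, circleMap 0 r θ ∉ S := by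
  have := (hS.preimage_circleMap 0 hr).measure_zero MeasureTheory.volume
  exact MeasureTheory.measure_eq_zero_iff_ae_notMem.1 this

lemma circleAverage_mono_of_countable {u v : ℂ → ℝ} {r : ℝ} (hr : r ≠ 0) {S : Set ℂ}
    (hS : S.Countable) (hu : CircleIntegrable u 0 r) (hv : CircleIntegrable v 0 r)
    (huv : ∀ z, ‖z‖ = |r| → z ∉ S → u z ≤ v z) :
    circleAverage u 0 r ≤ circleAverage v 0 r := by
  rw [circleAverage, circleAverage, smul_eq_mul, smul_eq_mul]
  refine mul_le_mul_of_nonneg_left ?_ (by positivity)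
  refine intervalIntegral.integral_mono_ae (by positivity) hu hv ?_
  filter_upwards [ae_circleMap_notMem_of_countable hS hr] with θ hθ
  exact huv _ (by simp) hθ

namespace ProximitySmall

variable {f : ℂ → ℂ} {E E' : ℂ → ℝ}

/-- The inequality is only needed outside the unit disc, as the radii are at least `1`, and off a
countable set. -/
lemma mono (h : ProximitySmall f E') (hm : Measurable E) {S : Set ℂ} (hS : S.Countable)
    (h0 : ∀ z, 0 ≤ E z) (hle : ∀ z, 1 ≤ ‖z‖ → z ∉ S → E z ≤ E' z) : ProximitySmall f E := by
  obtain ⟨-, K, hK, hK'⟩ := h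
  refine ⟨hm, K, hK, fun r δ L hb => ?_⟩
  obtain ⟨hi, hle'⟩ := hK' r δ L hb
  have hr : r ≠ 0 := by linarith [hb.one_le_radius]
  have hrabs : |r| = r := abs_of_pos (by linarith [hb.one_le_radius])
  have hpt : ∀ z, ‖z‖ = |r| → z ∉ S → log⁺ (E z) ≤ log⁺ (E' z) := fun z hz hzS =>
    posLog_le_posLog (h0 z) (hle z (by rw [hz, hrabs]; exact hb.one_le_radius) hzS)
  have hint : CircleIntegrable (fun z => log⁺ (E z)) 0 r := by
    refine IntervalIntegrable.mono_fun hi ?_ ?_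
    · exact (continuous_posLog.measurable.comp
        (hm.comp (continuous_circleMap 0 r).measurable)).aestronglyMeasurable
    · refine MeasureTheory.ae_restrict_of_ae ?_
      filter_upwards [ae_circleMap_notMem_of_countable hS hr] with θ hθ
      rw [Real.norm_of_nonneg posLog_nonneg, Real.norm_of_nonneg posLog_nonneg]
      exact hpt _ (by simp) hθ
  exact ⟨hint, (circleAverage_mono_of_countable hr hS hint hi hpt).trans hle'⟩

lemma mul (h : ProximitySmall f E) (h' : ProximitySmall f E') :
    ProximitySmall f fun z => E z * E' z := by
  obtain ⟨hm, K, hK, hK'⟩ := h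
  obtain ⟨hm', J, hJ, hJ'⟩ := h'
  refine ⟨hm.mul hm', K + J, by positivity, fun r δ L hb => ?_⟩
  obtain ⟨hi, hle⟩ := hK' r δ L hb
  obtain ⟨hi', hle'⟩ := hJ' r δ L hb
  have hsum := hi.fun_add hi'
  have hint : CircleIntegrable (fun z => log⁺ (E z * E' z)) 0 r := by
    refine IntervalIntegrable.mono_fun hsum ?_ (Eventually.of_forall fun θ => ?_)
    · exact (continuous_posLog.measurable.comp
        ((hm.mul hm').comp (continuous_circleMap 0 r).measurable)).aestronglyMeasurable
    · dsimp only
      rw [Real.norm_of_nonneg posLog_nonneg, Real.norm_of_nonneg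
        (add_nonneg posLog_nonneg posLog_nonneg)]
      exact posLog_mul
  refine ⟨hint, (circleAverage_mono hint hsum fun z _ => posLog_mul).trans ?_⟩
  rw [circleAverage_fun_add hi hi', add_mul]
  exact add_le_add hle hle'

lemma add (h : ProximitySmall f E) (h' : ProximitySmall f E') :
    ProximitySmall f fun z => E z + E' z := by
  obtain ⟨hm, K, hK, hK'⟩ := h
  obtain ⟨hm', J, hJ, hJ'⟩ := h'
  have hl2 : 0 ≤ log 2 := log_nonneg one_le_two
  refine ⟨hm.add hm', log 2 + K + J, by positivity, fun r δ L hb => ?_⟩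
  obtain ⟨hi, hle⟩ := hK' r δ L hb
  obtain ⟨hi', hle'⟩ := hJ' r δ L hb
  have hc : CircleIntegrable (fun _ : ℂ => log 2) 0 r := circleIntegrable_const _ _ _
  have hsum := (hc.fun_add hi).fun_add hi'
  have hint : CircleIntegrable (fun z => log⁺ (E z + E' z)) 0 r := by
    refine IntervalIntegrable.mono_fun hsum ?_ (Eventually.of_forall fun θ => ?_)
    · exact (continuous_posLog.measurable.comp
        ((hm.add hm').comp (continuous_circleMap 0 r).measurable)).aestronglyMeasurable
    · dsimp only
      rw [Real.norm_of_nonneg posLog_nonneg, Real.norm_of_nonneg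
        (add_nonneg (add_nonneg hl2 posLog_nonneg) posLog_nonneg)]
      exact posLog_add
  refine ⟨hint, (circleAverage_mono hint hsum fun z _ => posLog_add).trans ?_⟩
  rw [circleAverage_fun_add (hc.fun_add hi) hi', circleAverage_fun_add hc hi, circleAverage_const]
  have := mul_le_mul_of_nonneg_left hb.one_le_total hl2
  linarith

lemma const (c : ℝ) : ProximitySmall f fun _ => c := by
  refine ⟨measurable_const, log⁺ c, posLog_nonneg, fun r δ L hb => ⟨circleIntegrable_const _ _ _, ?_⟩⟩
  rw [circleAverage_const]
  exact le_mul_of_one_le_right posLog_nonneg hb.one_le_total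

lemma norm_id : ProximitySmall f fun z => ‖z‖ := by
  refine ⟨measurable_norm, 1, zero_le_one, fun r δ L hb => ⟨?_, ?_⟩⟩
  · exact circleIntegrable_posLog_norm_of_entire differentiable_id r
  · have hr := hb.one_le_radius
    have h1 : circleAverage (fun z : ℂ => log⁺ ‖z‖) 0 r = circleAverage (fun _ : ℂ => log r) 0 r := by
      refine circleAverage_congr_sphere fun z hz => ?_
      have hz' : ‖z‖ = r := by simpa [abs_of_pos (by linarith : 0 < r)] using hz
      rw [hz', posLog_eq_log (by rwa [abs_of_pos (by linarith)])]
    rw [h1, circleAverage_const]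
    linarith [hb.log_pos_nonpos, hb.log_bound_nonneg]

lemma pow (h : ProximitySmall f E) (n : ℕ) : ProximitySmall f fun z => E z ^ n := by
  induction n with
  | zero => simpa using const (f := f) 1
  | succ n ih => simpa only [pow_succ] using ih.mul h

lemma norm_polynomial (p : Polynomial ℂ) : ProximitySmall f fun z => ‖p.eval z‖ := by
  induction p using Polynomial.induction_on' with
  | add p q hp hq =>
    exact (hp.add hq).mono (p + q).continuous.norm.measurable Set.countable_empty
      (fun z => norm_nonneg _) fun z _ _ => by rw [Polynomial.eval_add]; exact norm_add_le _ _
  | monomial n a =>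
    simpa only [Polynomial.eval_monomial, norm_mul, norm_pow] using
      (const ‖a‖).mul (norm_id.pow n)

/-- Lemma on the logarithmic derivative: if the growth of `g` is controlled by that of `f`, then
`g' / g` has small proximity function. -/
lemma norm_logDeriv {g : ℂ → ℂ} (hg : Differentiable ℂ g) (hne : ∃ z, g z ≠ 0)
    (hfg : GrowthControlled f g) : ProximitySmall f fun z => ‖logDeriv g z‖ := by
  obtain ⟨K, hK0, hK⟩ := exists_circleAverage_posLog_logDeriv_le hg hne
  obtain ⟨J, hJ0, hJ⟩ := hfg
  have hl2 : 0 ≤ log 2 := log_nonneg one_le_two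
  have hlJ : 0 ≤ log (1 + J) := log_nonneg (by linarith)
  refine ⟨((measurable_deriv g).div hg.continuous.measurable).norm,
    K * (2 + log 2 + log (1 + J)), by positivity, fun r δ L hb => ⟨?_, ?_⟩⟩
  · exact MeromorphicOn.circleIntegrable_posLog_norm fun z _ =>
      (hg.analyticAt z).meromorphicAt.logDeriv
  · have hP := hb.one_le_product
    have hl := hb.one_le_logs
    have hL := hb.one_le_bound
    have hδ := hb.pos
    have h1 := hK r (δ / 2) ((1 + J) * (L * (1 + log r - log δ))) hb.one_le_radius
      (by positivity) (by linarith [hb.le_one]) (one_le_mul_of_one_le_of_one_le (by linarith) hP)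
      fun z hz => (hJ r δ L hb z hz).trans (exp_le_exp.2 (by nlinarith))
    refine h1.trans ?_
    rw [mul_assoc K]
    refine mul_le_mul_of_nonneg_left ?_ hK0
    rw [log_mul (by linarith) (by linarith), log_mul (by linarith) (by linarith),
      log_div hδ.ne' two_ne_zero]
    have h2 : log (1 + log r - log δ) ≤ 1 + log r - log δ - 1 :=
      log_le_sub_one_of_pos (by linarith)
    have hT := hb.one_le_total
    have e1 := mul_le_mul_of_nonneg_left hT hl2
    have e2 := mul_le_mul_of_nonneg_left hT hlJ
    linarith [hb.log_bound_nonneg, hb.log_radius_nonneg, hb.log_pos_nonpos]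

end ProximitySmall

lemma iteratedDeriv_differentiable {f : ℂ → ℂ} (hf : Differentiable ℂ f) (k : ℕ) :
    Differentiable ℂ (iteratedDeriv k f) :=
  (hf.contDiff (n := ⊤)).differentiable_iteratedDeriv k (by exact_mod_cast WithTop.coe_lt_top _)

/-- Iterating the lemma on the logarithmic derivative along the derivatives of `f`. -/
lemma ProximitySmall.norm_iteratedDeriv_div {f : ℂ → ℂ} (hf : Differentiable ℂ f)
    (hne : ∀ k, ∃ z, iteratedDeriv k f z ≠ 0) (k : ℕ) :
    ProximitySmall f fun z => ‖iteratedDeriv k f z / f z‖ := by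
  have hmeas : ∀ k, Measurable fun z => ‖iteratedDeriv k f z / f z‖ := fun k =>
    ((iteratedDeriv_differentiable hf k).continuous.measurable.div hf.continuous.measurable).norm
  induction k with
  | zero =>
    refine (ProximitySmall.const 1).mono (hmeas 0) Set.countable_empty (fun z => norm_nonneg _)
      fun z _ _ => ?_
    rw [iteratedDeriv_zero, norm_div]
    exact div_self_le_one _
  | succ k ih =>
    have hd := iteratedDeriv_differentiable hf k
    refine (ih.mul (ProximitySmall.norm_logDeriv hd (hne k)
      (GrowthControlled.iteratedDeriv hf k))).mono (hmeas (k + 1)) (countable_zeros hd (hne k))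
      (fun z => norm_nonneg _) fun z _ hz => ?_
    have hz' : iteratedDeriv k f z ≠ 0 := hz
    rw [← norm_mul, logDeriv_apply, iteratedDeriv_succ]
    refine le_of_eq (congrArg norm ?_)
    field_simp

/-! ### Entire functions with small proximity function are polynomials -/

/-- Jensen's inequality: circle averages of `log ‖φ‖` are bounded below. -/
lemma exists_le_circleAverage_log_norm {φ : ℂ → ℂ} (hφ : Differentiable ℂ φ)
    (hne : ∃ z, φ z ≠ 0) :
    ∃ C : ℝ, ∀ r, 1 ≤ r → C ≤ circleAverage (fun z => log ‖φ z‖) 0 r := by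
  obtain ⟨k, h, hh, h0, hfac⟩ := exists_eq_pow_mul hφ hne
  refine ⟨log ‖h 0‖, fun r hr => ?_⟩
  have hr0 : 0 < r := by linarith
  have h1 := log_norm_le_poisson (mem_ball_self hr0) hh h0
  refine h1.trans (circleAverage_mono (circleIntegrable_kernel_mul (mem_ball_self hr0)
    (circleIntegrable_log_norm_of_entire hh r)) (circleIntegrable_log_norm_of_entire hφ r)
    fun z hz => ?_)
  have hz' : ‖z‖ = r := by simpa [abs_of_pos hr0] using hz
  have hz0 : z ≠ 0 := by
    rintro rfl
    rw [norm_zero] at hz'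
    linarith
  rw [herglotzRieszKernel_def]
  simp only [sub_zero, add_zero, div_self hz0, Complex.one_re, one_mul]
  by_cases hhz : h z = 0
  · rw [hfac, hhz, mul_zero]
  · rw [hfac, norm_mul]
    refine log_le_log (norm_pos_iff.2 hhz) (le_mul_of_one_le_left (norm_nonneg _) ?_)
    rw [norm_pow, hz']
    exact one_le_pow₀ hr

/-- If `φ` and `f φ` have small proximity function, then so does `f`. -/
lemma ProximitySmall.of_mul {f φ : ℂ → ℂ} (hf : Differentiable ℂ f) (hφ : Differentiable ℂ φ)
    (hne : ∃ z, φ z ≠ 0) (h₁ : ProximitySmall f fun z => ‖φ z‖)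
    (h₂ : ProximitySmall f fun z => ‖f z * φ z‖) : ProximitySmall f fun z => ‖f z‖ := by
  obtain ⟨-, K, hK, hK'⟩ := h₁
  obtain ⟨-, J, hJ, hJ'⟩ := h₂
  obtain ⟨C, hC⟩ := exists_le_circleAverage_log_norm hφ hne
  refine ⟨hf.continuous.norm.measurable, K + J + |C|, by positivity, fun r δ L hb =>
    ⟨circleIntegrable_posLog_norm_of_entire hf r, ?_⟩⟩
  obtain ⟨hi, hle⟩ := hK' r δ L hb
  obtain ⟨hi', hle'⟩ := hJ' r δ L hb
  have hr := hb.one_le_radius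
  have hl := circleIntegrable_log_norm_of_entire hφ r
  have h3 : circleAverage (fun z => log⁺ ‖f z‖) 0 r ≤
      circleAverage (fun z => log⁺ ‖f z * φ z‖ + log⁺ ‖φ z‖ - log ‖φ z‖) 0 r := by
    refine circleAverage_mono_of_countable (by linarith) (countable_zeros hφ hne)
      (circleIntegrable_posLog_norm_of_entire hf r) ((hi'.fun_add hi).fun_sub hl)
      fun z _ hz => ?_
    have hz' : ‖φ z‖ ≠ 0 := norm_ne_zero_iff.2 hz
    have e1 : ‖f z‖ = ‖f z * φ z‖ * ‖φ z‖⁻¹ := by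
      rw [norm_mul]; field_simp
    have e2 := posLog_mul (x := ‖f z * φ z‖) (y := ‖φ z‖⁻¹)
    rw [← e1] at e2
    have e3 := posLog_sub_posLog_inv (x := ‖φ z‖)
    linarith
  rw [circleAverage_fun_sub (hi'.fun_add hi) hl, circleAverage_fun_add hi' hi] at h3
  have h4 := hC r hr
  have h5 := mul_le_mul_of_nonneg_left hb.one_le_total (abs_nonneg C)
  linarith [neg_abs_le C]

/-- Borel's growth lemma, in the weak form that a locally bounded function cannot more than double
at every step `r ↦ r + 1 / T r`. -/
lemma exists_radius_growth_le {T : ℝ → ℝ} {r₀ : ℝ} (hT : ∀ r, r₀ ≤ r → 1 ≤ T r)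
    (hbdd : ∃ B, ∀ r, r₀ ≤ r → r ≤ r₀ + 2 → T r ≤ B) :
    ∃ r, r₀ ≤ r ∧ T (r + 1 / T r) ≤ 2 * T r := by
  by_contra! hcon
  obtain ⟨B, hB⟩ := hbdd
  have hseq : ∀ n : ℕ, ∃ r, r₀ ≤ r ∧ r ≤ r₀ + 2 - 2 * (1 / 2) ^ n ∧ 2 ^ n ≤ T r := by
    intro n
    induction n with
    | zero => exact ⟨r₀, le_rfl, by norm_num, by simpa using hT r₀ le_rfl⟩
    | succ n ih =>
      obtain ⟨r, h1, h2, h3⟩ := ih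
      have hpos : 0 < T r := by linarith [hT r h1]
      have hstep : 1 / T r ≤ (1 / 2) ^ n := by
        rw [one_div_pow]
        exact one_div_le_one_div_of_le (by positivity) h3
      have h4 := hcon r h1
      refine ⟨r + 1 / T r, by linarith [one_div_pos.2 hpos], ?_, ?_⟩
      · rw [pow_succ]; linarith
      · rw [pow_succ]; linarith
  obtain ⟨n, hn⟩ := pow_unbounded_of_one_lt B one_lt_two
  obtain ⟨r, h1, h2, h3⟩ := hseq n
  have := hB r h1 (by linarith [pow_pos (by norm_num : (0 : ℝ) < 1 / 2) n])
  linarith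

lemma exists_circleAverage_posLog_le {f : ℂ → ℂ} (hf : Differentiable ℂ f) {R : ℝ} :
    ∃ B, ∀ r, 0 ≤ r → r ≤ R → circleAverage (fun z => log⁺ ‖f z‖) 0 r ≤ B := by
  obtain ⟨M, hM⟩ := exists_norm_le_of_continuous hf.continuous R
  refine ⟨log⁺ M, fun r hr hrR => circleAverage_mono_on_of_le_circle
    (circleIntegrable_posLog_norm_of_entire hf r) fun z hz => ?_⟩
  have hz' : ‖z‖ = r := by simpa [abs_of_nonneg hr] using hz
  exact posLog_le_posLog (norm_nonneg _) (hM z (by linarith))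

/-- A function that is small compared with itself grows at most like a polynomial on a sequence
of circles. -/
lemma exists_circleAverage_posLog_le_log {f : ℂ → ℂ} (hf : Differentiable ℂ f)
    (hsmall : ProximitySmall f fun z => ‖f z‖) : ∃ K : ℝ, 0 ≤ K ∧ ∀ r₀ : ℝ, 1 ≤ r₀ →
      ∃ r, r₀ ≤ r ∧ circleAverage (fun z => log⁺ ‖f z‖) 0 r ≤ K * (1 + log r) := by
  obtain ⟨-, J, hJ, hJ'⟩ := hsmall
  set T : ℝ → ℝ := fun r => circleAverage (fun z => log⁺ ‖f z‖) 0 r with hTdef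
  set a : ℝ := 6 * (J + 1) with ha
  have ha1 : 0 ≤ log a := log_nonneg (by linarith)
  have hl32 : 0 ≤ log 32 := log_nonneg (by norm_num)
  refine ⟨1 + 2 * J * (1 + log 32 + 3 * log a + 2), by positivity, fun r₀ hr₀ => ?_⟩
  -- the growth lemma needs `T ≥ 1`; otherwise the claim is trivial
  by_cases hlow : ∃ r, r₀ ≤ r ∧ T r < 1
  · obtain ⟨r, hr, hTr⟩ := hlow
    refine ⟨r, hr, hTr.le.trans (one_le_mul_of_one_le_of_one_le ?_ ?_)⟩
    · have : 0 ≤ 2 * J * (1 + log 32 + 3 * log a + 2) := by positivity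
      linarith
    · linarith [log_nonneg (hr₀.trans hr)]
  push Not at hlow
  obtain ⟨B, hB⟩ := exists_circleAverage_posLog_le hf (R := r₀ + 2)
  obtain ⟨r, hr, hgrow⟩ := exists_radius_growth_le hlow
    ⟨B, fun r h1 h2 => hB r (by linarith) h2⟩
  refine ⟨r, hr, ?_⟩
  change T r ≤ _
  have hT1 := hlow r hr
  have hr1 : 1 ≤ r := hr₀.trans hr
  -- the bound at radius `r + δ` comes from the circle of radius `r + 2 δ = r + 1 / T r`
  set δ := 1 / (2 * T r) with hδ
  have hδ0 : 0 < δ := by positivity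
  have hδ1 : δ ≤ 1 / 2 := by
    rw [hδ]
    exact one_div_le_one_div_of_le (by norm_num) (by linarith)
  have hTδ : 1 / T r = 2 * δ := by rw [hδ]; field_simp
  have hb : DiscBound f r δ (16 * T r ^ 2 * r) := by
    refine ⟨hr1, hδ0, by linarith, ?_, fun z hz => ?_⟩
    · nlinarith [one_le_pow₀ hT1 (n := 2)]
    · by_cases hfz : f z = 0
      · rw [hfz, norm_zero]; exact (exp_pos _).le
      rw [← exp_log (norm_pos_iff.2 hfz), exp_le_exp]
      have h1 := log_norm_le_mul_circleAverage (by linarith : 0 ≤ r + δ)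
        (by linarith : r + δ < r + 2 * δ) hf hz
      rw [hTδ] at hgrow
      refine h1.trans ?_
      have h2 : (r + 2 * δ + (r + δ)) / (r + 2 * δ - (r + δ)) = (2 * r + 3 * δ) * (2 * T r) := by
        have : r + 2 * δ - (r + δ) = δ := by ring
        rw [this, hδ]
        field_simp
        ring
      rw [h2]
      calc (2 * r + 3 * δ) * (2 * T r) * T (r + 2 * δ)
          ≤ (4 * r) * (2 * T r) * (2 * T r) := by
            have : 0 ≤ (2 * r + 3 * δ) * (2 * T r) := by positivity
            refine mul_le_mul ?_ hgrow ?_ (by positivity)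
            · gcongr; linarith
            · exact circleAverage_nonneg_of_nonneg fun _ _ => posLog_nonneg
        _ = _ := by ring
  have hmain := (hJ' r δ _ hb).2
  change T r ≤ _ at hmain
  have hlogδ : log δ = -(log 2 + log (T r)) := by
    rw [hδ, one_div, log_inv, log_mul two_ne_zero (by linarith)]
  have hlogL : log (16 * T r ^ 2 * r) = log 16 + 2 * log (T r) + log r := by
    rw [log_mul (by positivity) (by linarith), log_mul (by norm_num) (by positivity), log_pow]
    push_cast; ring
  have hlog32 : log 32 = log 2 + log 16 := by
    rw [← log_mul (by norm_num) (by norm_num)]; norm_num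
  -- `a` is large enough for the term `3 J log (T r)` to be absorbed on the left
  have hlogT : log (T r) ≤ T r / a + log a := by
    have ha0 : 0 < a := by linarith
    have := log_le_sub_one_of_pos (div_pos (by linarith : 0 < T r) ha0)
    rw [log_div (by linarith) ha0.ne'] at this
    linarith
  have hJT : 3 * J * (T r / a) ≤ T r / 2 := by
    rw [mul_div_assoc', div_le_div_iff₀ (by linarith) two_pos, ha]
    nlinarith
  have hfin : T r ≤ 2 * J * (1 + log 32 + 3 * log a + 2 * log r) := by
    have : T r ≤ J * (1 + log 32 + 2 * log r + 3 * log (T r)) := by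
      refine hmain.trans (le_of_eq ?_)
      rw [hlogδ, hlogL, hlog32]; ring
    nlinarith [mul_le_mul_of_nonneg_left hlogT (by positivity : 0 ≤ 3 * J)]
  refine hfin.trans ?_
  have hlr : 0 ≤ log r := log_nonneg hr1
  have e1 : 2 * J * (1 + log 32 + 3 * log a + 2 * log r) ≤
      2 * J * ((1 + log 32 + 3 * log a + 2) * (1 + log r)) := by
    refine mul_le_mul_of_nonneg_left ?_ (by positivity)
    nlinarith [mul_nonneg (by positivity : 0 ≤ 1 + log 32 + 3 * log a) hlr]
  nlinarith

/-- Cauchy's estimates on the given circles kill all high Taylor coefficients. -/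
lemma exists_iteratedDeriv_eq_zero_of_le_log {f : ℂ → ℂ} (hf : Differentiable ℂ f) {K : ℝ}
    (hle : ∀ r₀ : ℝ, 1 ≤ r₀ →
      ∃ r, r₀ ≤ r ∧ circleAverage (fun z => log⁺ ‖f z‖) 0 r ≤ K * (1 + log r)) :
    ∃ k : ℕ, ∀ j, k ≤ j → iteratedDeriv j f 0 = 0 := by
  obtain ⟨k, hk⟩ := exists_nat_ge (3 * K + 1)
  refine ⟨k, fun j hj => ?_⟩
  by_contra hne
  have hpos : 0 < ‖iteratedDeriv j f 0‖ := norm_pos_iff.2 hne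
  set D := log (j.factorial : ℝ) + 3 * K + j * log 2 - log ‖iteratedDeriv j f 0‖ with hD
  obtain ⟨r, hr, hTr⟩ := hle (max 1 (exp (D + 1))) (le_max_left _ _)
  have hr1 : 1 ≤ r := (le_max_left _ _).trans hr
  have hrD : D + 1 ≤ log r := by
    rw [← log_exp (D + 1)]
    exact log_le_log (exp_pos _) ((le_max_right _ _).trans hr)
  have hbound : ∀ z ∈ sphere (0 : ℂ) (r / 2), ‖f z‖ ≤ exp (3 * (K * (1 + log r))) := by
    intro z hz
    by_cases hfz : f z = 0
    · rw [hfz, norm_zero]; exact (exp_pos _).le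
    rw [← exp_log (norm_pos_iff.2 hfz), exp_le_exp]
    have hz' : ‖z‖ ≤ r / 2 := by simpa using (mem_sphere.1 hz).le
    have h1 := log_norm_le_mul_circleAverage (by linarith : 0 ≤ r / 2)
      (by linarith : r / 2 < r) hf hz'
    have h2 : (r + r / 2) / (r - r / 2) = 3 := by
      have : r ≠ 0 := by linarith
      field_simp
      norm_num
    rw [h2] at h1
    linarith
  have hC := Complex.norm_iteratedDeriv_le_of_forall_mem_sphere_norm_le j
    (by linarith : 0 < r / 2) hf.diffContOnCl hbound
  have hlog := log_le_log hpos hC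
  have hfac : (0 : ℝ) < j.factorial := by exact_mod_cast j.factorial_pos
  rw [log_div (by positivity) (by positivity), log_mul hfac.ne' (exp_pos _).ne', log_exp, log_pow,
    log_div (by linarith) two_ne_zero] at hlog
  have hjk : (k : ℝ) ≤ j := by exact_mod_cast hj
  have hlr : 0 ≤ log r := log_nonneg hr1
  nlinarith

lemma exists_polynomial_of_iteratedDeriv_eq_zero {f : ℂ → ℂ} (hf : Differentiable ℂ f) {k : ℕ}
    (hk : ∀ j, k ≤ j → iteratedDeriv j f 0 = 0) : ∃ p : Polynomial ℂ, ∀ z, f z = p.eval z := by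
  refine ⟨∑ j ∈ Finset.range k, Polynomial.monomial j ((j.factorial : ℂ)⁻¹ * iteratedDeriv j f 0),
    fun z => ?_⟩
  have h := Complex.hasSum_taylorSeries_of_entire hf 0 z
  have h' := hasSum_sum_of_ne_finset_zero (L := SummationFilter.unconditional ℕ) (s := Finset.range k)
    (f := fun n : ℕ => ((n.factorial : ℂ))⁻¹ • (z - 0) ^ n • iteratedDeriv n f 0) (fun j hj => by
      rw [hk j (by simpa using hj), smul_zero, smul_zero])
  rw [h.unique h', Polynomial.eval_finsetSum]
  refine Finset.sum_congr rfl fun j _ => ?_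
  rw [Polynomial.eval_monomial, sub_zero, smul_eq_mul, smul_eq_mul]
  ring

lemma exists_iteratedDeriv_eq_zero_of_small {f : ℂ → ℂ} (hf : Differentiable ℂ f)
    (hsmall : ProximitySmall f fun z => ‖f z‖) :
    ∃ k : ℕ, ∀ j, k ≤ j → iteratedDeriv j f 0 = 0 := by
  obtain ⟨K, -, hK⟩ := exists_circleAverage_posLog_le_log hf hsmall
  exact exists_iteratedDeriv_eq_zero_of_le_log hf hK

/-! ### Linear differential relations between entire functions -/

lemma exists_notMem_of_countable {S : Set ℂ} (hS : S.Countable) : ∃ z, z ∉ S :=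
  (hS.dense_compl ℝ).nonempty

lemma exists_polynomial_eval_ne_zero {p : Polynomial ℂ} (hp : p ≠ 0) : ∃ z, p.eval z ≠ 0 := by
  by_contra! h
  exact hp (Polynomial.funext fun z => by simpa using h z)

/-- Two solutions of the differential equation `p y' = β y` are proportional. -/
lemma exists_eq_mul_of_deriv_eq {u v p β : ℂ → ℂ} (hu : Differentiable ℂ u)
    (hv : Differentiable ℂ v) (hp : Differentiable ℂ p) (hu0 : ∃ z, u z ≠ 0) (hp0 : ∃ z, p z ≠ 0)
    (hpu : ∀ z, p z * deriv u z = β z * u z) (hpv : ∀ z, p z * deriv v z = β z * v z) :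
    ∃ c : ℂ, ∀ z, v z = c * u z := by
  obtain ⟨z₀, hz₀⟩ := exists_notMem_of_countable
    ((countable_zeros hu hu0).union (countable_zeros hp hp0))
  have hne : u z₀ ≠ 0 ∧ p z₀ ≠ 0 := ⟨fun h => hz₀ (Or.inl h), fun h => hz₀ (Or.inr h)⟩
  have hev : ∀ᶠ z in 𝓝 z₀, u z ≠ 0 ∧ p z ≠ 0 :=
    (hu.continuous.continuousAt.eventually_ne hne.1).and
      (hp.continuous.continuousAt.eventually_ne hne.2)
  obtain ⟨ε, hε, hball⟩ := Metric.eventually_nhds_iff_ball.1 hev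
  have hconst : ∀ z ∈ ball z₀ ε, v z / u z = v z₀ / u z₀ := by
    intro z hz
    refine (convex_ball z₀ ε).is_const_of_fderivWithin_eq_zero (𝕜 := ℂ)
      (f := fun z => v z / u z) ?_ ?_ hz (mem_ball_self hε)
    · intro w hw
      exact ((hv w).div (hu w) (hball w hw).1).differentiableWithinAt
    · intro w hw
      obtain ⟨huw, hpw⟩ := hball w hw
      rw [fderivWithin_of_isOpen isOpen_ball hw]
      have h1 : (deriv v w * u w - v w * deriv u w) / u w ^ 2 = 0 := by
        rw [div_eq_zero_iff]
        left
        refine mul_left_cancel₀ hpw ?_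
        linear_combination u w * hpv w - v w * hpu w
      have h2 : HasDerivAt (fun z => v z / u z) 0 w :=
        h1 ▸ (hv w).hasDerivAt.div (hu w).hasDerivAt huw
      ext
      simp [h2.hasFDerivAt.fderiv]
  refine ⟨v z₀ / u z₀, fun z => ?_⟩
  have heq : v = fun z => v z₀ / u z₀ * u z := by
    refine AnalyticOnNhd.eq_of_eventuallyEq (z₀ := z₀)
      (hv.differentiableOn.analyticOnNhd isOpen_univ)
      ((hu.const_mul (v z₀ / u z₀)).differentiableOn.analyticOnNhd isOpen_univ) ?_
    filter_upwards [ball_mem_nhds z₀ hε] with w hw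
    rw [← hconst w hw, div_mul_cancel₀ _ (hball w hw).1]
  exact congrFun heq z

/-- An entire function with finitely many zeros has logarithmic derivative `β / p` with a polynomial
`p` and an entire function `β`. -/
lemma exists_polynomial_mul_deriv_eq {F : ℂ → ℂ} (hF : Differentiable ℂ F)
    (hne : ∃ z, F z ≠ 0) (hfin : {z | F z = 0}.Finite) :
    ∃ (p : Polynomial ℂ) (β : ℂ → ℂ), p ≠ 0 ∧ Differentiable ℂ β ∧
      ∀ z, p.eval z * deriv F z = β z * F z := by
  obtain ⟨ρ, hρ⟩ := hfin.isBounded.exists_norm_le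
  obtain ⟨N, a, h, hh, -, hfac, hz⟩ := exists_factorization_closedBall hF hne
    (by positivity : 0 < max ρ 1)
  have hh0 : ∀ z, h z ≠ 0 := fun z h0 =>
    hz z ((hρ z (by simp [hfac, h0])).trans (le_max_left _ _)) h0
  set p : Polynomial ℂ := ∏ i ∈ Finset.range N, (Polynomial.X - Polynomial.C (a i)) with hp
  have hpe : ∀ z, p.eval z = ∏ i ∈ Finset.range N, (z - a i) := by
    intro z
    rw [hp, Polynomial.eval_prod]
    simp
  have hFp : F = fun z => p.eval z * h z := by
    funext z
    rw [hfac, hpe]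
  refine ⟨p, fun z => p.derivative.eval z + p.eval z * (deriv h z / h z),
    Polynomial.Monic.ne_zero (Polynomial.monic_prod_of_monic _ _ fun i _ =>
      Polynomial.monic_X_sub_C _), ?_, fun z => ?_⟩
  · exact p.derivative.differentiable.add (p.differentiable.mul (hh.deriv.div hh hh0))
  · have hd : deriv F z = p.derivative.eval z * h z + p.eval z * deriv h z := by
      rw [hFp]
      exact ((p.hasDerivAt z).mul (hh z).hasDerivAt).deriv
    rw [hd, hFp]
    field_simp [hh0 z]

/-! ### The Tumura–Clunie argument -/

namespace IsTranscendentalEntire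

variable {f : ℂ → ℂ}

lemma not_iteratedDeriv_eq_zero (hf : IsTranscendentalEntire f) :
    ¬ ∃ k : ℕ, ∀ j, k ≤ j → iteratedDeriv j f 0 = 0 := fun ⟨_, hk⟩ =>
  hf.2 (exists_polynomial_of_iteratedDeriv_eq_zero hf.1 hk)

lemma exists_iteratedDeriv_ne_zero (hf : IsTranscendentalEntire f) (k : ℕ) :
    ∃ z, iteratedDeriv k f z ≠ 0 := by
  by_contra! h
  refine hf.not_iteratedDeriv_eq_zero ⟨k, fun j hj => ?_⟩
  have hk : iteratedDeriv k f = fun _ => 0 := funext h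
  obtain ⟨i, rfl⟩ := Nat.exists_eq_add_of_le' hj
  rw [iteratedDeriv_eq_iterate] at hk ⊢
  rw [Function.iterate_add_apply, hk, ← iteratedDeriv_eq_iterate]
  simp

lemma exists_ne_zero (hf : IsTranscendentalEntire f) : ∃ z, f z ≠ 0 := by
  simpa using hf.exists_iteratedDeriv_ne_zero 0

/-- Multiplication with a small entire function `φ ≠ 0` does not make a transcendental entire function
small. -/
lemma not_proximitySmall_mul (hf : IsTranscendentalEntire f) {φ : ℂ → ℂ}
    (hφ : Differentiable ℂ φ) (hne : ∃ z, φ z ≠ 0) (h₁ : ProximitySmall f fun z => ‖φ z‖) :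
    ¬ ProximitySmall f fun z => ‖f z * φ z‖ := fun h₂ =>
  hf.not_iteratedDeriv_eq_zero
    (exists_iteratedDeriv_eq_zero_of_small hf.1 (ProximitySmall.of_mul hf.1 hφ hne h₁ h₂))

/-- No derivative of a transcendental entire function is rational. -/
lemma not_polynomial_mul_iteratedDeriv_eq (hf : IsTranscendentalEntire f) {B C : Polynomial ℂ}
    (hB : B ≠ 0) (q : ℕ) : ¬ ∀ z, B.eval z * iteratedDeriv q f z = C.eval z := by
  intro h
  have hd := iteratedDeriv_differentiable hf.1 q
  obtain ⟨k, hk⟩ := exists_iteratedDeriv_eq_zero_of_small hd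
    (ProximitySmall.of_mul hd B.differentiable (exists_polynomial_eval_ne_zero hB)
      (ProximitySmall.norm_polynomial B)
      (by simpa only [mul_comm _ (B.eval _), h] using ProximitySmall.norm_polynomial C))
  refine hf.not_iteratedDeriv_eq_zero ⟨k + q, fun j hj => ?_⟩
  obtain ⟨i, rfl⟩ := Nat.exists_eq_add_of_le' hj
  have := hk (i + k) (by omega)
  rw [iteratedDeriv_eq_iterate, iteratedDeriv_eq_iterate, ← Function.iterate_add_apply] at this
  rwa [← add_assoc, iteratedDeriv_eq_iterate]

/-- A transcendental entire function satisfies no relation `G f ^ n = B f⁽q⁾ - C` with polynomial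
coefficients and `n ≥ 2`. -/
lemma not_pow_eq (hf : IsTranscendentalEntire f) {G B C : Polynomial ℂ} (hG : G ≠ 0) {n : ℕ}
    (hn : 2 ≤ n) (q : ℕ) :
    ¬ ∀ z, G.eval z * f z ^ n = B.eval z * iteratedDeriv q f z - C.eval z := by
  intro h
  refine hf.not_proximitySmall_mul G.differentiable (exists_polynomial_eval_ne_zero hG)
    (ProximitySmall.norm_polynomial G) ?_
  have hv := ProximitySmall.norm_iteratedDeriv_div hf.1 hf.exists_iteratedDeriv_ne_zero q
  refine ((ProximitySmall.norm_polynomial G).add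
    (((ProximitySmall.norm_polynomial B).mul hv).add (ProximitySmall.norm_polynomial C))).mono
    (hf.1.continuous.mul G.continuous).norm.measurable (countable_zeros hf.1 hf.exists_ne_zero)
    (fun z => norm_nonneg _) fun z _ hz => ?_
  have hfz : f z ≠ 0 := hz
  have hfpos : 0 < ‖f z‖ := norm_pos_iff.2 hfz
  rw [norm_mul]
  have hrest : 0 ≤ ‖B.eval z‖ * ‖iteratedDeriv q f z / f z‖ + ‖C.eval z‖ := by positivity
  -- where `‖f‖ ≥ 1`, dividing the relation by `f` leaves at least one factor `f` on the left
  rcases le_total ‖f z‖ 1 with h1 | h1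
  · have := mul_le_of_le_one_left (norm_nonneg (G.eval z)) h1
    linarith
  · have e1 : ‖G.eval z‖ * ‖f z‖ ^ n ≤
        ‖f z‖ * (‖B.eval z‖ * ‖iteratedDeriv q f z / f z‖ + ‖C.eval z‖) := by
      rw [← norm_pow, ← norm_mul, h z]
      refine (norm_sub_le _ _).trans ?_
      have e2 : ‖B.eval z * iteratedDeriv q f z‖
          = ‖f z‖ * (‖B.eval z‖ * ‖iteratedDeriv q f z / f z‖) := by
        rw [norm_mul, norm_div]; field_simp
      rw [e2, mul_add]
      have := le_mul_of_one_le_left (norm_nonneg (C.eval z)) h1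
      linarith
    have e3 : ‖f z‖ ^ 2 ≤ ‖f z‖ ^ n := pow_le_pow_right₀ h1 hn
    have e4 : ‖f z‖ * (‖f z‖ * ‖G.eval z‖) ≤
        ‖f z‖ * (‖B.eval z‖ * ‖iteratedDeriv q f z / f z‖ + ‖C.eval z‖) := by
      refine le_trans ?_ e1
      calc ‖f z‖ * (‖f z‖ * ‖G.eval z‖) = ‖G.eval z‖ * ‖f z‖ ^ 2 := by ring
        _ ≤ _ := by gcongr
    have := le_of_mul_le_mul_left e4 hfpos
    linarith [norm_nonneg (G.eval z)]

end IsTranscendentalEntire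

/-- If `x ^ (n - 1) φ` grows at most linearly in `x` where `‖x‖ ≥ 1`, and `φ` is `O(x)` anyway,
then `φ` and `x φ` are both bounded. The case `‖x‖ ≥ 1` is where `n ≥ 3` is needed. -/
lemma norm_mul_le_of_pow_relation {x φ t E : ℂ} {e : ℝ} {n : ℕ} (hn : 3 ≤ n)
    (hrel : x ^ (n - 1) * φ = t) (ht : 1 ≤ ‖x‖ → ‖t‖ ≤ ‖x‖ * e)
    (hφ : φ = x * E) (hE : ‖E‖ ≤ e) : ‖φ‖ ≤ e ∧ ‖x * φ‖ ≤ e := by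
  rw [norm_mul]
  rcases le_total ‖x‖ 1 with h1 | h1
  · have h2 : ‖φ‖ ≤ e := by
      rw [hφ, norm_mul]
      exact (mul_le_of_le_one_left (norm_nonneg _) h1).trans hE
    exact ⟨h2, (mul_le_of_le_one_left (norm_nonneg _) h1).trans h2⟩
  · have hpos : 0 < ‖x‖ := by linarith
    have h2 : ‖x‖ * (‖x‖ * ‖φ‖) ≤ ‖x‖ * e := by
      refine le_trans ?_ (ht h1)
      rw [← hrel, norm_mul, norm_pow, ← mul_assoc, ← pow_two]
      gcongr
      omega
    have h3 := le_of_mul_le_mul_left h2 hpos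
    exact ⟨(le_mul_of_one_le_left (norm_nonneg _) h1).trans h3, h3⟩

namespace IsTranscendentalEntire

variable {f : ℂ → ℂ}

/-- With polynomial coefficients, `A f ^ n + B f⁽q⁾ - C` has infinitely many zeros. -/
theorem infinite_zeros_polynomial (hf : IsTranscendentalEntire f) {A B C : Polynomial ℂ}
    (hA : A ≠ 0) (hB : B ≠ 0) {n : ℕ} (hn : 3 ≤ n) (q : ℕ) :
    {z | A.eval z * f z ^ n + B.eval z * iteratedDeriv q f z - C.eval z = 0}.Infinite := by
  intro hfin
  have hfd := hf.1
  have hqd := iteratedDeriv_differentiable hfd q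
  set D : ℂ → ℂ := fun z => B.eval z * iteratedDeriv q f z - C.eval z with hD
  set G : ℂ → ℂ := fun z => A.eval z * f z ^ n with hG
  set F : ℂ → ℂ := fun z => G z + D z with hFdef
  have hDd : Differentiable ℂ D := (B.differentiable.mul hqd).sub C.differentiable
  have hGd : Differentiable ℂ G := A.differentiable.mul (hfd.pow n)
  have hFd : Differentiable ℂ F := hGd.add hDd
  have hfinF : {z | F z = 0}.Finite := by
    refine hfin.subset fun z hz => ?_
    have hz' : F z = 0 := hz
    simp only [hFdef, hG, hD] at hz'
    change A.eval z * f z ^ n + B.eval z * iteratedDeriv q f z - C.eval z = 0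
    rw [← hz']; ring
  have hF0 : ∃ z, F z ≠ 0 := exists_notMem_of_countable hfinF.countable
  obtain ⟨p, β, hp, hβ, hpβ⟩ := exists_polynomial_mul_deriv_eq hFd hF0 hfinF
  -- derivatives of the two parts of `F`
  have hdG : ∀ z, deriv G z = A.derivative.eval z * f z ^ n
      + A.eval z * (n * f z ^ (n - 1) * deriv f z) := fun z =>
    ((A.hasDerivAt z).mul ((hfd z).hasDerivAt.pow n)).deriv
  have hdD : ∀ z, deriv D z = B.derivative.eval z * iteratedDeriv q f z
      + B.eval z * iteratedDeriv (q + 1) f z - C.derivative.eval z := fun z => by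
    rw [iteratedDeriv_succ]
    exact (((B.hasDerivAt z).mul (hqd z).hasDerivAt).sub (C.hasDerivAt z)).deriv
  have hdF : ∀ z, deriv F z = deriv G z + deriv D z := fun z =>
    ((hGd z).hasDerivAt.add (hDd z).hasDerivAt).deriv
  have hpow : ∀ z, f z ^ n = f z ^ (n - 1) * f z := fun z => by
    rw [← pow_succ]; congr 1; omega
  -- `f ^ (n - 1) * φ` is `p G' - β G` with the common factor `f ^ (n - 1)` taken out; since `F = G + D`
  -- satisfies `p F' = β F`, it also equals `β D - p D'`, which is only linear in `f`.
  set φ : ℂ → ℂ := fun z => p.eval z * (A.derivative.eval z * f z + n * A.eval z * deriv f z)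
    - β z * A.eval z * f z with hφdef
  have hφd : Differentiable ℂ φ := by
    refine (p.differentiable.mul ((A.derivative.differentiable.mul hfd).add
      (((differentiable_const _).mul A.differentiable).mul hfd.deriv))).sub
      ((hβ.mul A.differentiable).mul hfd)
  have hφG : ∀ z, f z ^ (n - 1) * φ z = p.eval z * deriv G z - β z * G z := fun z => by
    rw [hdG]; simp only [hφdef, hG, hpow]; ring
  have hφD : ∀ z, f z ^ (n - 1) * φ z = β z * D z - p.eval z * deriv D z := fun z => by
    rw [hφG]
    have h1 := hpβ z
    rw [hdF] at h1
    simp only [hFdef] at h1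
    linear_combination h1
  by_cases hφ0 : ∃ z, φ z ≠ 0
  · -- `φ` and `f φ` are small, by the two expressions for `φ`
    have hFc : GrowthControlled f F := by
      have h0 : GrowthControlled f f := by
        simpa using GrowthControlled.iteratedDeriv hfd 0
      exact ((GrowthControlled.polynomial A).mul (h0.pow n)).add
        (((GrowthControlled.polynomial B).mul (GrowthControlled.iteratedDeriv hfd q)).sub
          (GrowthControlled.polynomial C))
    -- the pointwise bound `e` below is built from polynomials, `F' / F` and quotients `f⁽ʲ⁾ / f`
    have hb := ProximitySmall.norm_logDeriv hFd hF0 hFc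
    have hu := ProximitySmall.norm_iteratedDeriv_div hfd hf.exists_iteratedDeriv_ne_zero 1
    have hv := ProximitySmall.norm_iteratedDeriv_div hfd hf.exists_iteratedDeriv_ne_zero q
    have hw := ProximitySmall.norm_iteratedDeriv_div hfd hf.exists_iteratedDeriv_ne_zero (q + 1)
    have poly (s : Polynomial ℂ) : ProximitySmall f fun z => ‖s.eval z‖ :=
      ProximitySmall.norm_polynomial s
    have hE := (poly p).mul (((hb.mul ((((poly B).mul hv).add (poly C)).add (poly A))).add
      ((((poly B.derivative).mul hv).add ((poly B).mul hw)).add (poly C.derivative))).add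
      ((poly A.derivative).add (((ProximitySmall.const n).mul (poly A)).mul hu)))
    have hcount := (countable_zeros hfd hf.exists_ne_zero).union hfinF.countable
    have hbound : ∀ z, z ∉ {z | f z = 0} ∪ {z | F z = 0} → _ ∧ _ := fun z hz => by
      have hfz : f z ≠ 0 := fun h => hz (Or.inl h)
      have hFz : F z ≠ 0 := fun h => hz (Or.inr h)
      have hβz : β z = p.eval z * logDeriv F z := by
        rw [logDeriv_apply, mul_div_assoc', hpβ z, mul_div_cancel_right₀ _ hFz]
      refine norm_mul_le_of_pow_relation (x := f z) (φ := φ z)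
        (E := p.eval z * (A.derivative.eval z + n * A.eval z * (iteratedDeriv 1 f z / f z)
          - logDeriv F z * A.eval z))
        (e := ‖p.eval z‖ * (‖logDeriv F z‖ * (‖B.eval z‖ * ‖iteratedDeriv q f z / f z‖
            + ‖C.eval z‖ + ‖A.eval z‖)
          + (‖B.derivative.eval z‖ * ‖iteratedDeriv q f z / f z‖
            + ‖B.eval z‖ * ‖iteratedDeriv (q + 1) f z / f z‖ + ‖C.derivative.eval z‖)
          + (‖A.derivative.eval z‖ + n * ‖A.eval z‖ * ‖iteratedDeriv 1 f z / f z‖)))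
        hn (hφD z) (fun h1 => ?_) ?_ ?_
      · set v := iteratedDeriv q f z / f z with hvdef
        set w := iteratedDeriv (q + 1) f z / f z with hwdef
        have ev : iteratedDeriv q f z = v * f z := by rw [hvdef]; field_simp
        have ew : iteratedDeriv (q + 1) f z = w * f z := by rw [hwdef]; field_simp
        rw [hdD, hβz]
        simp only [hD]
        rw [ev, ew]
        have t1 : ‖B.eval z * (v * f z) - C.eval z‖ ≤
            ‖f z‖ * (‖B.eval z‖ * ‖v‖ + ‖C.eval z‖ + ‖A.eval z‖) := by
          refine (norm_sub_le _ _).trans ?_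
          rw [norm_mul, norm_mul]
          nlinarith [norm_nonneg (C.eval z), norm_nonneg (A.eval z),
            mul_nonneg (norm_nonneg (f z)) (norm_nonneg (A.eval z))]
        have t2 : ‖B.derivative.eval z * (v * f z) + B.eval z * (w * f z) - C.derivative.eval z‖ ≤
            ‖f z‖ * (‖B.derivative.eval z‖ * ‖v‖ + ‖B.eval z‖ * ‖w‖ + ‖C.derivative.eval z‖) := by
          refine (norm_sub_le _ _).trans ((add_le_add_left (norm_add_le _ _) _).trans ?_)
          rw [norm_mul, norm_mul, norm_mul, norm_mul]
          nlinarith [norm_nonneg (C.derivative.eval z)]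
        have t3 : 0 ≤ ‖A.derivative.eval z‖ + n * ‖A.eval z‖ * ‖iteratedDeriv 1 f z / f z‖ := by
          positivity
        refine (norm_sub_le _ _).trans ?_
        rw [norm_mul, norm_mul, norm_mul]
        calc _ ≤ ‖p.eval z‖ * ‖logDeriv F z‖ *
                  (‖f z‖ * (‖B.eval z‖ * ‖v‖ + ‖C.eval z‖ + ‖A.eval z‖))
                + ‖p.eval z‖ * (‖f z‖ * (‖B.derivative.eval z‖ * ‖v‖ + ‖B.eval z‖ * ‖w‖
                  + ‖C.derivative.eval z‖)) := by gcongr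
          _ ≤ _ := by
            have := mul_nonneg (mul_nonneg (norm_nonneg (f z)) (norm_nonneg (p.eval z))) t3
            linarith
      · simp only [hφdef, hβz, iteratedDeriv_one]
        field_simp
      · rw [norm_mul]
        refine mul_le_mul_of_nonneg_left ?_ (norm_nonneg _)
        refine (norm_sub_le _ _).trans ((add_le_add_left (norm_add_le _ _) _).trans ?_)
        rw [norm_mul, norm_mul, norm_mul, Complex.norm_natCast]
        have t4 : 0 ≤ ‖logDeriv F z‖ * (‖B.eval z‖ * ‖iteratedDeriv q f z / f z‖
            + ‖C.eval z‖) := by positivity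
        have t5 : 0 ≤ ‖B.derivative.eval z‖ * ‖iteratedDeriv q f z / f z‖
            + ‖B.eval z‖ * ‖iteratedDeriv (q + 1) f z / f z‖ + ‖C.derivative.eval z‖ := by
          positivity
        linarith
    exact hf.not_proximitySmall_mul hφd hφ0
      (hE.mono hφd.continuous.norm.measurable hcount (fun _ => norm_nonneg _)
        fun z _ hz => (hbound z hz).1)
      (hE.mono (hfd.continuous.mul hφd.continuous).norm.measurable hcount (fun _ => norm_nonneg _)
        fun z _ hz => (hbound z hz).2)
  · -- `F` and `A f ^ n` satisfy the same first order equation, so they are proportional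
    push Not at hφ0
    have hG0 : ∃ z, G z ≠ 0 := by
      obtain ⟨z, hz⟩ := exists_notMem_of_countable
        ((countable_zeros A.differentiable (exists_polynomial_eval_ne_zero hA)).union
          (countable_zeros hfd hf.exists_ne_zero))
      exact ⟨z, mul_ne_zero (fun h => hz (Or.inl h)) (pow_ne_zero _ fun h => hz (Or.inr h))⟩
    obtain ⟨c, hc⟩ := exists_eq_mul_of_deriv_eq hGd hFd p.differentiable hG0
      (exists_polynomial_eval_ne_zero hp) (β := β)
      (fun z => by
        have := hφG z
        rw [hφ0, mul_zero] at this
        exact (sub_eq_zero.1 this.symm)) hpβ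
    have hrel : ∀ z, D z = (c - 1) * G z := fun z => by
      have := hc z
      simp only [hFdef] at this
      linear_combination this
    by_cases hc1 : c = 1
    · refine hf.not_polynomial_mul_iteratedDeriv_eq hB q (C := C) fun z => ?_
      have := hrel z
      rw [hc1, sub_self, zero_mul] at this
      exact sub_eq_zero.1 this
    · refine hf.not_pow_eq (G := Polynomial.C (c - 1) * A) (B := B) (C := C)
        (mul_ne_zero (Polynomial.C_ne_zero.2 (sub_ne_zero.2 hc1)) hA) (by omega : 2 ≤ n) q
        fun z => ?_
      rw [Polynomial.eval_mul, Polynomial.eval_C, mul_assoc]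
      exact (hrel z).symm

end IsTranscendentalEntire

/-! ### Rational coefficients -/

lemma ratValue_eq_div (Q : RatFunc ℂ) (z : ℂ) : ratValue Q z = Q.num.eval z / Q.denom.eval z := by
  simp [ratValue, RatFunc.eval, Polynomial.eval₂_eq_eval_map]

lemma noPoleAt_of_neg {Q : RatFunc ℂ} {z : ℂ} (h : NoPoleAt (-Q) z) : NoPoleAt Q z := by
  have hdvd : Q.denom ∣ (-Q).denom := by
    have h1 : Q.denom ∣ -Q.num * (-Q).denom := by
      rw [← RatFunc.num_denom_neg]
      exact dvd_mul_left _ _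
    exact (Q.isCoprime_num_denom.symm.neg_right).dvd_of_dvd_mul_left h1
  exact fun h0 => h (Polynomial.eval_eq_zero_of_dvd_of_eval_eq_zero hdvd h0)

lemma ratValue_neg {Q : RatFunc ℂ} {z : ℂ} (h : NoPoleAt (-Q) z) :
    ratValue (-Q) z = -ratValue Q z := by
  have h1 : (-Q).denom.eval z ≠ 0 := h
  have h2 : Q.denom.eval z ≠ 0 := noPoleAt_of_neg h
  have h3 := congrArg (Polynomial.eval z) (RatFunc.num_denom_neg Q)
  simp only [Polynomial.eval_mul, Polynomial.eval_neg] at h3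
  rw [ratValue_eq_div, ratValue_eq_div]
  field_simp
  linear_combination h3

/-- Multiplying by the denominators reduces rational coefficients to polynomial ones, at the cost of
finitely many points. -/
theorem IsTranscendentalEntire.infinite_zeros_ratFunc {f : ℂ → ℂ} (hf : IsTranscendentalEntire f)
    {Q₁ Q₂ R : RatFunc ℂ} (hQ₁ : Q₁ ≠ 0) (hQ₂ : Q₂ ≠ 0) {n : ℕ} (hn : 3 ≤ n) (q : ℕ) :
    {z : ℂ | NoPoleAt Q₁ z ∧ NoPoleAt Q₂ z ∧ NoPoleAt R z ∧
      ratValue Q₁ z * f z ^ n + ratValue Q₂ z * iteratedDeriv q f z - ratValue R z = 0}.Infinite := by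
  have h₁ := Q₁.denom_ne_zero
  have h₂ := Q₂.denom_ne_zero
  have h₃ := R.denom_ne_zero
  have hinf := hf.infinite_zeros_polynomial (A := Q₁.num * (Q₂.denom * R.denom))
    (B := Q₂.num * (Q₁.denom * R.denom)) (C := R.num * (Q₁.denom * Q₂.denom))
    (mul_ne_zero (RatFunc.num_ne_zero hQ₁) (mul_ne_zero h₂ h₃))
    (mul_ne_zero (RatFunc.num_ne_zero hQ₂) (mul_ne_zero h₁ h₃)) hn q
  have hfin : {z | (Q₁.denom * Q₂.denom * R.denom).IsRoot z}.Finite :=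
    Polynomial.finite_setOfPred_isRoot (mul_ne_zero (mul_ne_zero h₁ h₂) h₃)
  refine (hinf.sdiff hfin).mono ?_
  rintro z ⟨hz, hroot⟩
  have hroot' : ¬ (Q₁.denom * Q₂.denom * R.denom).eval z = 0 := hroot
  rw [Polynomial.eval_mul, Polynomial.eval_mul, mul_eq_zero, mul_eq_zero] at hroot'
  push Not at hroot'
  obtain ⟨⟨d₁, d₂⟩, d₃⟩ := hroot'
  refine ⟨d₁, d₂, d₃, ?_⟩
  have hz' : (Q₁.num * (Q₂.denom * R.denom)).eval z * f z ^ n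
    + (Q₂.num * (Q₁.denom * R.denom)).eval z * iteratedDeriv q f z
    - (R.num * (Q₁.denom * Q₂.denom)).eval z = 0 := hz
  simp only [Polynomial.eval_mul] at hz'
  rw [ratValue_eq_div, ratValue_eq_div, ratValue_eq_div]
  field_simp
  linear_combination hz'

theorem corollary1p8 (f : ℂ → ℂ) (hf : IsTranscendentalEntire f)
    (Q₁ Q₂ R : RatFunc ℂ) (hQ₁ : Q₁ ≠ 0) (hQ₂ : Q₂ ≠ 0)
    (n : ℕ) (hn : 3 ≤ n) (q : ℕ) :
    {z : ℂ | NoPoleAt Q₁ z ∧ NoPoleAt Q₂ z ∧ NoPoleAt R z ∧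
      ratValue Q₁ z * f z ^ n + ratValue Q₂ z * iteratedDeriv q f z - ratValue R z = 0}.Infinite ∧
    {z : ℂ | NoPoleAt Q₁ z ∧ NoPoleAt Q₂ z ∧
      ratValue Q₁ z * f z ^ n - ratValue Q₂ z * iteratedDeriv q f z = z}.Infinite := by
  refine ⟨hf.infinite_zeros_ratFunc hQ₁ hQ₂ hn q, ?_⟩
  -- the fixed points are the zeros for the coefficients `Q₁`, `-Q₂` and `R = X`
  refine (hf.infinite_zeros_ratFunc (R := RatFunc.X) hQ₁ (neg_ne_zero.2 hQ₂) hn q).mono ?_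
  rintro z ⟨h₁, h₂, -, h⟩
  have hX : ratValue RatFunc.X z = z := RatFunc.eval_X _ _
  rw [ratValue_neg h₂, hX] at h
  exact ⟨h₁, noPoleAt_of_neg h₂, by linear_combination h⟩
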